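/- Let $n\ge 2$ be an even integer, and let $v_n$ be the volume of the unit ball of $\mathbb R^n$. For a continuous function $f:\mathbb R^n\to\mathbb R$, $x\in\mathbb R^n$ and $t>0$ put \[\mathcal M_t f(x)=\frac1{v_n t^n}\int_{B(x,t)}\frac{f(y)}{(t^2-|x-y|^2)^{1/2}}\,dy .\] Let $d_n^{-1}=n(n-2)\cdots 2$, and let $\varphi\in C^{(n+4)/2}(\mathbb R^n)$ and $\psi\in C^{(n+2)/2}(\mathbb R^n)$ be real-valued (in particular, $\varphi,\psi$ may be any smooth functions). Then the integrals defining $\mathcal M_t\varphi(x)$ and $\mathcal M_t\psi(x)$ converge absolutely, for each $x$ the functions $t\mapsto t^n\mathcal M_t\varphi(x)$ and $t\mapsto t^n\mathcal M_t\psi(x)$ are respectively $n/2$ and $(n-2)/2$ times continuously differentiable on $(0,\infty)$, and the function \[u(x,t)=d_n\,\frac{\partial}{\partial t}\Big(\frac1t\frac{\partial}{\partial t}\Big)^{(n-2)/2}\big(t^n\mathcal M_t\varphi(x)\big)+d_n\Big(\frac1t\frac{\partial}{\partial t}\Big)^{(n-2)/2}\big(t^n\mathcal M_t\psi(x)\big),\qquad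 x\in\mathbb R^n,\ t>0,\] is a classical solution of the Cauchy problem for the wave equation: $u$ is $C^2$ on $\mathbb R^{n+1}_+=\{(x,t):x\in\mathbb R^n,\ t>0\}$, it satisfies $u_{tt}(x,t)=\nabla^2u(x,t)$ for all $x\in\mathbb R^n$, $t>0$, and $u(x,0)=\varphi(x)$, $u_t(x,0)=\psi(x)$ for all $x\in\mathbb R^n$. The initial conditions mean that $u(y,t)\to\varphi(x)$ and $u_t(y,t)\to\psi(x)$ as $(y,t)\to(x,0)$ with $t>0$, and also that, once $u$ is extended by $u(x,0)=\varphi(x)$, its one-sided time derivative at $t=0$ is $\psi(x)$. For $n=2$ this is Poisson's formula: for all $x\in\mathbb R^2$ and $t>0$, \[u(x,t)=\frac{\partial}{\partial t}\Big(\frac1{2\pi}\int_{B(x,t)}\frac{\varphi(y)}{(t^2-|x-y|^2)^{1/2}}\,dy\Big)+\frac1{2\pi}\int_{B(x,t)}\frac{\psi(y)}{(t^2-|x-y|^2)^{1/2}}\,dy .\] -/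

import Mathlib

open MeasureTheory Set Filter Topology
open scoped Laplacian

noncomputable section

/-- The volume `v_n` of the unit ball of `ℝⁿ`. -/
def unitBallVolume (n : ℕ) : ℝ :=
  (volume (Metric.ball (0 : EuclideanSpace ℝ (Fin n)) 1)).toReal

/-- The weighted integral `∫_{B(x,R)} (R² - |x - y|²)^{-1/2} f(y) dy`. -/
def weightedBallIntegral {n : ℕ} (R : ℝ) (f : EuclideanSpace ℝ (Fin n) → ℝ)
    (x : EuclideanSpace ℝ (Fin n)) : ℝ :=
  ∫ y in Metric.ball x R, 1 / Real.sqrt (R ^ 2 - ‖x - y‖ ^ 2) * f y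

/-- The weighted ball average `𝓜_R f (x)`. -/
def weightedBallMean {n : ℕ} (R : ℝ) (f : EuclideanSpace ℝ (Fin n) → ℝ)
    (x : EuclideanSpace ℝ (Fin n)) : ℝ :=
  1 / (unitBallVolume n * R ^ n) * weightedBallIntegral R f x

/-- The operator `t⁻¹ ∂_t`. -/
def invMulDeriv (f : ℝ → ℝ) : ℝ → ℝ := fun t => t⁻¹ * deriv f t

/-- The constant `d_n`, with `d_n⁻¹ = n (n - 2) ⋯ 2` for even `n`. -/
def evenWaveConst (n : ℕ) : ℝ := (Nat.doubleFactorial n : ℝ)⁻¹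

/-- The function `u` given by the even-dimensional solution formula (meaningful for `t > 0`). -/
def evenWaveSolution {n : ℕ} (φ ψ : EuclideanSpace ℝ (Fin n) → ℝ)
    (x : EuclideanSpace ℝ (Fin n)) (t : ℝ) : ℝ :=
  evenWaveConst n *
      deriv (invMulDeriv^[(n - 2) / 2] (fun s => s ^ n * weightedBallMean s φ x)) t +
    evenWaveConst n *
      (invMulDeriv^[(n - 2) / 2] (fun s => s ^ n * weightedBallMean s ψ x)) t

/-- `u`, of which only the values at times `t > 0` matter, is a classical (`C²`) solution in the
open upper half-space of the Cauchy problem `u_tt = Δ u`, `u(x,0) = φ(x)`, `u_t(x,0) = ψ(x)`.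
The values at `t = 0` are those of the continuous extensions of `u` and `u_t` to `t ≥ 0`, and
`ψ` is also the one-sided time derivative at `t = 0` of the extension of `u`. -/
structure IsWaveCauchySolution {n : ℕ} (φ ψ : EuclideanSpace ℝ (Fin n) → ℝ)
    (u : EuclideanSpace ℝ (Fin n) → ℝ → ℝ) : Prop where
  contDiffOn : ContDiffOn ℝ 2 (fun p : EuclideanSpace ℝ (Fin n) × ℝ => u p.1 p.2)
    {p | 0 < p.2}
  wave_eq : ∀ (x : EuclideanSpace ℝ (Fin n)) (t : ℝ), 0 < t →
    deriv (deriv (u x)) t = Δ (fun y => u y t) x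
  initial_value : ∀ x : EuclideanSpace ℝ (Fin n),
    Tendsto (fun p : EuclideanSpace ℝ (Fin n) × ℝ => u p.1 p.2)
      (𝓝[{p | 0 < p.2}] (x, 0)) (𝓝 (φ x))
  initial_velocity : ∀ x : EuclideanSpace ℝ (Fin n),
    Tendsto (fun p : EuclideanSpace ℝ (Fin n) × ℝ => deriv (u p.1) p.2)
      (𝓝[{p | 0 < p.2}] (x, 0)) (𝓝 (ψ x))
  initial_deriv : ∀ x : EuclideanSpace ℝ (Fin n),
    HasDerivWithinAt (Function.update (u x) 0 (φ x)) (ψ x) (Ici 0) 0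

end

/-!
For `n = 2k + 2`, rescaling the ball gives `t^n 𝓜_t f(x) = v_n⁻¹ t^(2k+1) F(x, t)` for `t > 0`,
where `F(x, t) = ∫_{|z| < 1} f(x + t z) (1 - |z|²)^{-1/2} dz` makes sense for all real `t` and is
as smooth in `(x, t)` as `f` is (`contDiff_ballMean`).

The function `F` satisfies the Euler–Poisson–Darboux equation `t F_tt + n F_t = t ΔF`
(`ballMean_eulerPoissonDarboux`). With `g(z) = f(x + t z)` and `w = (1 - |z|²)^{-1/2}`, this says
that the divergence of the vector field `w (z (z · ∇g) - ∇g)` has integral zero over the unit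
ball. The normal component of the field vanishes at the boundary but the field itself is unbounded
there, so `w` is first replaced by a `C¹` weight vanishing outside the ball
(`integral_divergence_radial`, `integral_inv_sqrt_mul_eq_zero`).

If `t H_tt + c H_t = t ΔH`, then `t H_t + (c - 1) H` satisfies the same equation with `c - 2` in
place of `c` (`darbouxStep_eulerPoissonDarboux`). These are the operators into which `t⁻¹ ∂_t`
turns when powers of `t` are taken out, whence `(t⁻¹ ∂_t)^k (t^(2k+1) F) = t H`, where `H`
satisfies the equation with `c = n - 2k = 2` (`iterate_invMulDeriv_eq`,
`darbouxIter_eulerPoissonDarboux`). This equation for `H` is the wave equation for `t H`, and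
`H(x, 0) = (2k+1)!! F(x, 0)` is a multiple of `f(x)`; the constant follows from
`∫ w = v_n n!! / (n-1)!!` (`integral_ball_inv_sqrt`). So `d_n v_n⁻¹ t H` solves the Cauchy problem
with data `0` and `f`, its time derivative the one with data `f` and `0`. Both are `C²` up to and
across `t = 0`, which gives the initial conditions.
-/

/-! ### The mass of the weight on the unit ball -/

theorem hasDerivAt_sqrt_one_sub_sq {r : ℝ} (hr : r ∈ Ioo (0 : ℝ) 1) :
    HasDerivAt (fun r => √(1 - r ^ 2)) (-(r * (1 / √(1 - r ^ 2)))) r := by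
  have h1 : 0 < 1 - r ^ 2 := by nlinarith [hr.1, hr.2]
  convert ((hasDerivAt_pow 2 r).const_sub 1).sqrt h1.ne' using 1
  have := Real.sqrt_pos.2 h1
  push_cast
  field_simp

theorem intervalIntegrable_pow_div_sqrt (k : ℕ) :
    IntervalIntegrable (fun r : ℝ => r ^ (2 * k + 1) * (1 / √(1 - r ^ 2))) volume 0 1 := by
  -- `r / √(1 - r²)` is nonnegative and is the derivative of `-√(1 - r²)`, so it is integrable.
  have h0 : IntervalIntegrable (fun r : ℝ => r * (1 / √(1 - r ^ 2))) volume 0 1 := by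
    rw [intervalIntegrable_iff_integrableOn_Ioc_of_le zero_le_one]
    refine intervalIntegral.integrableOn_deriv_of_nonneg (g := fun r => -√(1 - r ^ 2))
      (by fun_prop) ?_ ?_
    · intro r hr
      exact (hasDerivAt_sqrt_one_sub_sq hr).fun_neg.congr_deriv (by simp)
    · intro r hr
      have := hr.1.le
      positivity
  have := h0.continuousOn_mul (g := fun r : ℝ => r ^ (2 * k)) (by fun_prop)
  refine this.congr ?_
  intro r _
  simp only
  ring

/-- The recursion `(2k + 3) I_{k+1} = (2k + 2) I_k` comes from integrating the derivative of
`r ^ (2k + 2) √(1 - r²)`, a function vanishing at both endpoints. -/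
theorem integral_pow_div_sqrt (k : ℕ) :
    ∫ r in (0 : ℝ)..1, r ^ (2 * k + 1) * (1 / √(1 - r ^ 2)) =
      (Nat.doubleFactorial (2 * k) : ℝ) / Nat.doubleFactorial (2 * k + 1) := by
  induction k with
  | zero =>
    have := intervalIntegral.integral_eq_sub_of_hasDerivAt_of_le (f := fun r => -√(1 - r ^ 2))
      zero_le_one (by fun_prop) (f' := fun r => r ^ (2 * 0 + 1) * (1 / √(1 - r ^ 2))) ?_
      (intervalIntegrable_pow_div_sqrt 0)
    · rw [this]; simp
    · intro r hr
      exact (hasDerivAt_sqrt_one_sub_sq hr).fun_neg.congr_deriv (by simp)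
  | succ k ih =>
    have hi := ((intervalIntegrable_pow_div_sqrt k).const_mul (2 * k + 2)).sub
      ((intervalIntegrable_pow_div_sqrt (k + 1)).const_mul (2 * k + 3))
    have := intervalIntegral.integral_eq_sub_of_hasDerivAt_of_le
      (f := fun r => r ^ (2 * k + 2) * √(1 - r ^ 2)) zero_le_one (by fun_prop) ?_ hi
    · rw [intervalIntegral.integral_sub ((intervalIntegrable_pow_div_sqrt k).const_mul _)
        ((intervalIntegrable_pow_div_sqrt (k + 1)).const_mul _),
        intervalIntegral.integral_const_mul, intervalIntegral.integral_const_mul, ih] at this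
      simp only [one_pow, sub_self, Real.sqrt_zero, mul_zero, ne_eq, Nat.add_eq_zero_iff,
        OfNat.ofNat_ne_zero, and_false, not_false_eq_true, zero_pow, zero_mul] at this
      have e1 : 2 * (k + 1) + 1 = (2 * k + 1) + 2 := by ring
      have e2 : 2 * (k + 1) = 2 * k + 2 := by ring
      rw [e1] at this ⊢
      rw [e2, Nat.doubleFactorial_add_two, Nat.doubleFactorial_add_two]
      have h2 : (Nat.doubleFactorial (2 * k + 1) : ℝ) ≠ 0 := by positivity
      have h3 : (2 * (k : ℝ) + 3) ≠ 0 := by positivity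
      push_cast
      rw [sub_eq_zero] at this
      have h4 : (2 * (k : ℝ) + 1 + 2) ≠ 0 := by positivity
      field_simp at this ⊢
      linear_combination -this
    · intro r hr
      have h1 : 0 < 1 - r ^ 2 := by nlinarith [hr.1, hr.2]
      have h2 := Real.sqrt_pos.2 h1
      refine ((hasDerivAt_pow (2 * k + 2) r).mul (hasDerivAt_sqrt_one_sub_sq hr)).congr_deriv ?_
      push_cast
      field_simp
      rw [Real.sq_sqrt h1.le]
      ring

theorem integrableOn_ball_inv_sqrt (k : ℕ) :
    IntegrableOn (fun z : EuclideanSpace ℝ (Fin (2 * k + 2)) => 1 / √(1 - ‖z‖ ^ 2))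
      (Metric.ball 0 1) := by
  rw [integrableOn_fun_norm_addHaar volume (f := fun r => 1 / √(1 - r ^ 2))]
  have := intervalIntegrable_pow_div_sqrt k
  rw [intervalIntegrable_iff_integrableOn_Ioo_of_le zero_le_one] at this
  simpa using this

/-- The total mass of the weight `(1 - |z|²)^{-1/2}` is `v_n n!! / (n - 1)!!`. -/
theorem integral_ball_inv_sqrt (k : ℕ) :
    ∫ z : EuclideanSpace ℝ (Fin (2 * k + 2)) in Metric.ball 0 1, 1 / √(1 - ‖z‖ ^ 2) =
      unitBallVolume (2 * k + 2) * (Nat.doubleFactorial (2 * k + 2) : ℝ) /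
        Nat.doubleFactorial (2 * k + 1) := by
  have h1 : ∫ z : EuclideanSpace ℝ (Fin (2 * k + 2)) in Metric.ball 0 1, 1 / √(1 - ‖z‖ ^ 2) =
      ∫ z : EuclideanSpace ℝ (Fin (2 * k + 2)),
        (Iio (1 : ℝ)).indicator (fun r => 1 / √(1 - r ^ 2)) ‖z‖ := by
    rw [← integral_indicator measurableSet_ball]
    congr 1 with z
    simp [indicator]
  rw [h1, integral_fun_norm_addHaar]
  have h2 : ∫ y in Ioi (0 : ℝ), y ^ (Module.finrank ℝ (EuclideanSpace ℝ (Fin (2 * k + 2))) - 1) •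
      (Iio (1 : ℝ)).indicator (fun r => 1 / √(1 - r ^ 2)) y =
      ∫ r in (0 : ℝ)..1, r ^ (2 * k + 1) * (1 / √(1 - r ^ 2)) := by
    rw [intervalIntegral.integral_of_le zero_le_one, integral_Ioc_eq_integral_Ioo,
      ← Ioi_inter_Iio, ← setIntegral_indicator measurableSet_Iio]
    congr 1 with y
    simp [indicator]
  rw [h2, integral_pow_div_sqrt, Nat.doubleFactorial_add_two]
  simp [unitBallVolume, Measure.real]
  ring

/-! ### Parametric integrals -/

section ParametricIntegral

variable {P E : Type} [NormedAddCommGroup P] [NormedSpace ℝ P] [FiniteDimensional ℝ P]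
  [NormedAddCommGroup E] [NormedSpace ℝ E] [FiniteDimensional ℝ E] [MeasurableSpace E]
  [BorelSpace E]

theorem Continuous.integrable_of_ae_mem_compact {G : Type} [NormedAddCommGroup G]
    {μ : Measure E} [IsFiniteMeasure μ] {K : Set E} (hK : IsCompact K) (hμ : ∀ᵐ z ∂μ, z ∈ K)
    {f : E → G} (hf : Continuous f) :
    Integrable f μ := by
  obtain ⟨C, hC⟩ := hK.exists_bound_of_continuousOn hf.continuousOn
  have : SecondCountableTopologyEither E G := inferInstance
  exact Integrable.of_bound hf.aestronglyMeasurable C (hμ.mono fun z hz => hC z hz)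

variable {G : Type} [NormedAddCommGroup G] [NormedSpace ℝ G]

theorem hasFDerivAt_integral_of_contDiff {μ : Measure E} [IsFiniteMeasure μ] {K : Set E}
    (hK : IsCompact K) (hμ : ∀ᵐ z ∂μ, z ∈ K) {Φ : P × E → G} (hΦ : ContDiff ℝ 1 Φ) (p : P) :
    HasFDerivAt (fun p => ∫ z, Φ (p, z) ∂μ)
      (∫ z, (fderiv ℝ Φ (p, z)).comp (ContinuousLinearMap.inl ℝ P E) ∂μ) p := by
  have hc : Continuous fun q : P × E =>
      (fderiv ℝ Φ q).comp (ContinuousLinearMap.inl ℝ P E) :=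
    (hΦ.continuous_fderiv one_ne_zero).clm_comp continuous_const
  obtain ⟨C, hC⟩ := ((isCompact_closedBall p 1).prod hK).exists_bound_of_continuousOn
    hc.continuousOn
  refine hasFDerivAt_integral_of_dominated_of_fderiv_le (Metric.closedBall_mem_nhds p one_pos)
    (bound := fun _ => C)
    (F' := fun p z => (fderiv ℝ Φ (p, z)).comp (ContinuousLinearMap.inl ℝ P E)) ?_ ?_ ?_ ?_ ?_ ?_
  · exact Eventually.of_forall fun q =>
      (hΦ.continuous.comp (by fun_prop)).aestronglyMeasurable
  · exact Continuous.integrable_of_ae_mem_compact hK hμ (hΦ.continuous.comp (by fun_prop))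
  · exact (hc.comp (by fun_prop : Continuous fun z : E => (p, z))).aestronglyMeasurable
  · filter_upwards [hμ] with z hz q hq
    exact hC (q, z) ⟨hq, hz⟩
  · exact integrable_const C
  · refine Eventually.of_forall fun z q _ => ?_
    have h1 := (hΦ.differentiable one_ne_zero (q, z)).hasFDerivAt
    exact h1.comp q (hasFDerivAt_prodMk_left q z)

theorem fderiv_integral_apply [CompleteSpace G] {μ : Measure E} [IsFiniteMeasure μ] {K : Set E}
    (hK : IsCompact K) (hμ : ∀ᵐ z ∂μ, z ∈ K) {Φ : P × E → G} (hΦ : ContDiff ℝ 1 Φ) (p v : P) :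
    fderiv ℝ (fun p => ∫ z, Φ (p, z) ∂μ) p v = ∫ z, fderiv ℝ Φ (p, z) (v, 0) ∂μ := by
  rw [(hasFDerivAt_integral_of_contDiff hK hμ hΦ p).fderiv,
    ContinuousLinearMap.integral_apply]
  · simp
  · refine Continuous.integrable_of_ae_mem_compact hK hμ ?_
    exact ((hΦ.continuous_fderiv one_ne_zero).comp (by fun_prop)).clm_comp continuous_const

/-- A parametric integral over a compactly supported finite measure is as smooth as its integrand.
The target `G` varies in the induction, the derivative being an integral with values in
`P →L[ℝ] G`. -/
theorem contDiff_integral_of_ae_mem_compact {μ : Measure E} [IsFiniteMeasure μ] {K : Set E}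
    (hK : IsCompact K) (hμ : ∀ᵐ z ∂μ, z ∈ K) (j : ℕ) :
    ∀ {G : Type} [NormedAddCommGroup G] [NormedSpace ℝ G] {Φ : P × E → G},
      ContDiff ℝ j Φ → ContDiff ℝ j (fun p => ∫ z, Φ (p, z) ∂μ) := by
  induction j with
  | zero =>
    intro G _ _ Φ hΦ
    have hc : Continuous Φ := hΦ.continuous
    refine contDiff_zero.2 (continuous_iff_continuousAt.2 fun p => ?_)
    obtain ⟨C, hC⟩ := ((isCompact_closedBall p 1).prod hK).exists_bound_of_continuousOn
      hc.continuousOn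
    refine continuousAt_of_dominated (bound := fun _ => C) ?_ ?_ (integrable_const C) ?_
    · exact Eventually.of_forall fun q => (hc.comp (by fun_prop)).aestronglyMeasurable
    · filter_upwards [Metric.closedBall_mem_nhds p one_pos] with q hq
      filter_upwards [hμ] with z hz
      exact hC (q, z) ⟨hq, hz⟩
    · exact Eventually.of_forall fun z => (hc.comp (by fun_prop)).continuousAt
  | succ j ih =>
    intro G _ _ Φ hΦ
    have h1 : ContDiff ℝ 1 Φ := hΦ.of_le (by exact_mod_cast Nat.le_add_left 1 j)
    rw [Nat.cast_add, Nat.cast_one, contDiff_succ_iff_hasFDerivAt]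
    refine ⟨_, ?_, hasFDerivAt_integral_of_contDiff hK hμ h1⟩
    refine ih (Φ := fun q => (fderiv ℝ Φ q).comp (ContinuousLinearMap.inl ℝ P E)) ?_
    exact (hΦ.fderiv_right (m := j) (by exact_mod_cast le_rfl)).clm_comp contDiff_const

end ParametricIntegral

/-! ### A divergence identity on the unit ball -/

theorem hasDerivAt_max_zero_sq (q : ℝ) :
    HasDerivAt (fun q : ℝ => max q 0 ^ 2) (2 * max q 0) q := by
  rcases lt_trichotomy q 0 with h | rfl | h
  · rw [max_eq_right h.le, mul_zero]
    refine (hasDerivAt_const q (0 : ℝ)).congr_of_eventuallyEq ?_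
    filter_upwards [Iio_mem_nhds h] with x hx
    simp [max_eq_right (le_of_lt (mem_Iio.1 hx))]
  · have : HasFDerivAt (fun q : ℝ => max q 0 ^ 2) (0 : ℝ →L[ℝ] ℝ) 0 := by
      refine Asymptotics.IsBigO.hasFDerivAt (n := 2) (Asymptotics.IsBigO.of_bound 1 ?_) one_lt_two
      refine Eventually.of_forall fun x => ?_
      simp only [sub_zero, norm_pow, Real.norm_eq_abs, abs_abs, one_mul]
      refine pow_le_pow_left₀ (abs_nonneg _) ?_ 2
      rw [abs_of_nonneg (le_max_right x 0)]
      exact max_le (le_abs_self x) (abs_nonneg x)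
    simpa using this.hasDerivAt
  · rw [max_eq_left h.le]
    have := hasDerivAt_pow 2 q
    simp only [Nat.cast_ofNat, Nat.add_one_sub_one, pow_one] at this
    refine this.congr_of_eventuallyEq ?_
    filter_upwards [Ioi_mem_nhds h] with x hx
    simp [max_eq_left (le_of_lt (mem_Ioi.1 hx))]

/-- A `C¹` regularisation of the function equal to `q^{-1/2}` for `q > 0` and to `0` for `q ≤ 0`:
for `q > 0` it is at most `q^{-1/2}`, to which it converges as `ε → 0⁺`. -/
noncomputable def regInvSqrt (ε q : ℝ) : ℝ := max q 0 ^ 2 * (q ^ 2 + ε) ^ (-(5 / 4) : ℝ)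

/-- The derivative of `regInvSqrt ε`. -/
noncomputable def regInvSqrtDeriv (ε q : ℝ) : ℝ :=
  2 * max q 0 * (q ^ 2 + ε) ^ (-(5 / 4) : ℝ) -
    5 / 2 * max q 0 ^ 2 * q * (q ^ 2 + ε) ^ (-(9 / 4) : ℝ)

theorem hasDerivAt_regInvSqrt {ε : ℝ} (hε : 0 < ε) (q : ℝ) :
    HasDerivAt (regInvSqrt ε) (regInvSqrtDeriv ε q) q := by
  have h0 : q ^ 2 + ε ≠ 0 := by positivity
  have h1 := ((hasDerivAt_pow 2 q).add_const ε).rpow_const (p := (-(5 / 4) : ℝ)) (Or.inl h0)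
  refine ((hasDerivAt_max_zero_sq q).mul h1).congr_deriv ?_
  rw [show (-(5 / 4) - 1 : ℝ) = -(9 / 4) by norm_num, regInvSqrtDeriv]
  push_cast
  ring

theorem continuous_regInvSqrtDeriv {ε : ℝ} (hε : 0 < ε) : Continuous (regInvSqrtDeriv ε) := by
  have h0 : ∀ q : ℝ, q ^ 2 + ε ≠ 0 := fun q => by positivity
  have h1 : ∀ a : ℝ, Continuous fun q : ℝ => (q ^ 2 + ε) ^ a := fun a =>
    Continuous.rpow_const (by fun_prop) fun q => Or.inl (h0 q)
  have := h1 (-(5 / 4))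
  have := h1 (-(9 / 4))
  unfold regInvSqrtDeriv
  fun_prop

theorem regInvSqrt_of_nonpos (ε : ℝ) {q : ℝ} (hq : q ≤ 0) : regInvSqrt ε q = 0 := by
  simp [regInvSqrt, max_eq_right hq]

theorem regInvSqrtDeriv_of_nonpos (ε : ℝ) {q : ℝ} (hq : q ≤ 0) : regInvSqrtDeriv ε q = 0 := by
  simp [regInvSqrtDeriv, max_eq_right hq]

theorem mul_regInvSqrtDeriv {ε q : ℝ} (hε : 0 < ε) (hq : 0 < q) :
    q * regInvSqrtDeriv ε q = regInvSqrt ε q * (2 - 5 / 2 * (q ^ 2 / (q ^ 2 + ε))) := by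
  have h0 : 0 < q ^ 2 + ε := by positivity
  rw [regInvSqrtDeriv, regInvSqrt, max_eq_left hq.le,
    show (-(9 / 4) : ℝ) = -(5 / 4) - 1 by norm_num, Real.rpow_sub_one h0.ne']
  ring

theorem sq_mul_sq_rpow {q : ℝ} (hq : 0 < q) : q ^ 2 * (q ^ 2) ^ (-(5 / 4) : ℝ) = 1 / √q := by
  rw [← Real.rpow_natCast, ← Real.rpow_mul hq.le, ← Real.rpow_add hq, Real.sqrt_eq_rpow,
    one_div, ← Real.rpow_neg hq.le]
  norm_num

theorem regInvSqrt_nonneg {ε : ℝ} (hε : 0 < ε) (q : ℝ) : 0 ≤ regInvSqrt ε q := by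
  unfold regInvSqrt
  positivity

theorem regInvSqrt_le {ε q : ℝ} (hε : 0 < ε) (hq : 0 < q) : regInvSqrt ε q ≤ 1 / √q := by
  rw [← sq_mul_sq_rpow hq, regInvSqrt, max_eq_left hq.le]
  refine mul_le_mul_of_nonneg_left ?_ (by positivity)
  exact Real.rpow_le_rpow_of_nonpos (by positivity) (by linarith) (by norm_num)

/-- The factor `q` matters: the derivative itself tends to `-q^{-3/2} / 2` as `ε → 0⁺`, which is not
integrable up to `q = 0`. -/
theorem abs_mul_regInvSqrtDeriv_le {ε q : ℝ} (hε : 0 < ε) (hq : 0 < q) :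
    |q * regInvSqrtDeriv ε q| ≤ 2 * (1 / √q) := by
  have h0 : 0 < q ^ 2 + ε := by positivity
  have h1 : q ^ 2 / (q ^ 2 + ε) ≤ 1 := (div_le_one h0).2 (by linarith)
  have h2 : 0 ≤ q ^ 2 / (q ^ 2 + ε) := by positivity
  rw [mul_regInvSqrtDeriv hε hq, abs_mul, abs_of_nonneg (regInvSqrt_nonneg hε q), mul_comm]
  refine mul_le_mul ?_ (regInvSqrt_le hε hq) (regInvSqrt_nonneg hε q) two_pos.le
  rw [abs_le]
  constructor <;> linarith

theorem tendsto_regInvSqrt {q : ℝ} (hq : 0 < q) :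
    Tendsto (fun ε => regInvSqrt ε q) (𝓝[>] 0) (𝓝 (1 / √q)) := by
  rw [← sq_mul_sq_rpow hq]
  unfold regInvSqrt
  rw [max_eq_left hq.le]
  refine Tendsto.const_mul _ ?_
  have : ContinuousAt (fun ε : ℝ => (q ^ 2 + ε) ^ (-(5 / 4) : ℝ)) 0 :=
    ContinuousAt.rpow_const (by fun_prop) (Or.inl (by positivity))
  simpa using this.tendsto.mono_left nhdsWithin_le_nhds

theorem tendsto_mul_regInvSqrtDeriv {q : ℝ} (hq : 0 < q) :
    Tendsto (fun ε => q * regInvSqrtDeriv ε q) (𝓝[>] 0) (𝓝 (-(1 / 2) * (1 / √q))) := by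
  have h1 : Tendsto (fun ε : ℝ => 2 - 5 / 2 * (q ^ 2 / (q ^ 2 + ε))) (𝓝[>] 0)
      (𝓝 (2 - 5 / 2 * (q ^ 2 / (q ^ 2 + 0)))) := by
    have : ContinuousAt (fun ε : ℝ => 2 - 5 / 2 * (q ^ 2 / (q ^ 2 + ε))) 0 := by
      refine ContinuousAt.sub continuousAt_const (ContinuousAt.mul continuousAt_const ?_)
      exact ContinuousAt.div continuousAt_const (by fun_prop) (by positivity)
    exact this.tendsto.mono_left nhdsWithin_le_nhds
  have h2 := (tendsto_regInvSqrt hq).mul h1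
  rw [add_zero, div_self (by positivity)] at h2
  rw [show -(1 / 2) * (1 / √q) = 1 / √q * (2 - 5 / 2 * 1) by ring]
  refine h2.congr' ?_
  filter_upwards [self_mem_nhdsWithin] with ε hε
  rw [mul_regInvSqrtDeriv hε hq]

theorem integral_fderiv_apply_eq_zero {E : Type} [NormedAddCommGroup E] [NormedSpace ℝ E]
    [FiniteDimensional ℝ E] [MeasurableSpace E] [BorelSpace E] (μ : Measure E)
    [μ.IsAddHaarMeasure] {u : E → ℝ} (hu : ContDiff ℝ 1 u) (hc : HasCompactSupport u) (v : E) :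
    ∫ z, fderiv ℝ u z v ∂μ = 0 := by
  have h1 : Continuous fun z => fderiv ℝ u z v :=
    (hu.continuous_fderiv one_ne_zero).clm_apply continuous_const
  have := integral_mul_fderiv_eq_neg_fderiv_mul_of_integrable (μ := μ) (f := fun _ => (1 : ℝ))
    (g := u) (v := v) (by simp) ?_ ?_ (by simp) fun z _ => hu.differentiable one_ne_zero z
  · simpa using this
  · simpa using h1.integrable_of_hasCompactSupport (hc.fderiv_apply ℝ v)
  · simpa using hu.continuous.integrable_of_hasCompactSupport hc

section Divergence

variable {n : ℕ}

theorem sum_coord_mul_clm (L : EuclideanSpace ℝ (Fin n) →L[ℝ] ℝ) (z : EuclideanSpace ℝ (Fin n)) :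
    ∑ i, z i * L (EuclideanSpace.single i 1) = L z := by
  have h : z = ∑ i, z i • EuclideanSpace.single i (1 : ℝ) := by
    have := (EuclideanSpace.basisFun (Fin n) ℝ).sum_repr z
    simpa using this.symm
  conv_rhs => rw [h]
  simp

/-- The divergence of the vector field `ρ(1 - |z|²) (z (z · ∇g) - ∇g)`, which vanishes outside the
unit ball, has integral `0`. Since `z · (z (z · ∇g) - ∇g) = -(1 - |z|²) (z · ∇g)`, the derivative
`ρ'` enters only through `q ρ'(q)`, where `q = 1 - |z|²`. -/
theorem integral_divergence_radial {g : EuclideanSpace ℝ (Fin n) → ℝ} (hg : ContDiff ℝ 2 g)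
    {ρ ρ' : ℝ → ℝ} (hρ : ∀ q, HasDerivAt ρ (ρ' q) q) (hρ' : Continuous ρ')
    (h0 : ∀ q ≤ 0, ρ q = 0) :
    ∫ z : EuclideanSpace ℝ (Fin n),
      (ρ (1 - ‖z‖ ^ 2) * ((n + 1) * fderiv ℝ g z z + fderiv ℝ (fderiv ℝ g) z z z -
        ∑ i, fderiv ℝ (fderiv ℝ g) z (EuclideanSpace.single i 1) (EuclideanSpace.single i 1)) +
      2 * ((1 - ‖z‖ ^ 2) * ρ' (1 - ‖z‖ ^ 2)) * fderiv ℝ g z z) = 0 := by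
  have hρ1 : ContDiff ℝ 1 ρ := by
    rw [contDiff_one_iff_deriv]
    refine ⟨fun q => (hρ q).differentiableAt, ?_⟩
    rwa [show deriv ρ = ρ' from funext fun q => (hρ q).deriv]
  have hg1 : ContDiff ℝ 1 (fderiv ℝ g) := hg.fderiv_right (by norm_num)
  set u : Fin n → EuclideanSpace ℝ (Fin n) → ℝ := fun i z =>
    ρ (1 - ‖z‖ ^ 2) * (z i * fderiv ℝ g z z - fderiv ℝ g z (EuclideanSpace.single i 1)) with hu
  have hw : ContDiff ℝ 1 fun z : EuclideanSpace ℝ (Fin n) => ρ (1 - ‖z‖ ^ 2) :=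
    hρ1.comp (contDiff_const.sub (contDiff_norm_sq ℝ))
  have huc : ∀ i, ContDiff ℝ 1 (u i) := fun i => by
    refine hw.mul (ContDiff.sub (ContDiff.mul ?_ (hg1.clm_apply contDiff_id))
      (hg1.clm_apply contDiff_const))
    exact (EuclideanSpace.proj (𝕜 := ℝ) i).contDiff
  have hus : ∀ i, HasCompactSupport (u i) := fun i => by
    refine HasCompactSupport.intro (isCompact_closedBall (0 : EuclideanSpace ℝ (Fin n)) 1) ?_
    intro z hz
    have : 1 - ‖z‖ ^ 2 ≤ 0 := by
      rw [mem_closedBall_zero_iff, not_le] at hz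
      nlinarith
    simp [hu, h0 _ this]
  have hd : ∀ i z, fderiv ℝ (u i) z (EuclideanSpace.single i 1) =
      -2 * ρ' (1 - ‖z‖ ^ 2) * z i *
        (z i * fderiv ℝ g z z - fderiv ℝ g z (EuclideanSpace.single i 1)) +
      ρ (1 - ‖z‖ ^ 2) * (fderiv ℝ g z z +
        z i * (fderiv ℝ (fderiv ℝ g) z (EuclideanSpace.single i 1) z +
          fderiv ℝ g z (EuclideanSpace.single i 1)) -
        fderiv ℝ (fderiv ℝ g) z (EuclideanSpace.single i 1) (EuclideanSpace.single i 1)) := by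
    intro i z
    have e1 := (hρ (1 - ‖z‖ ^ 2)).comp_hasFDerivAt z
      ((hasStrictFDerivAt_norm_sq z).hasFDerivAt.const_sub 1)
    have e2 : HasFDerivAt (fderiv ℝ g) (fderiv ℝ (fderiv ℝ g) z) z :=
      (hg1.differentiable one_ne_zero z).hasFDerivAt
    have e3 := e2.clm_apply (hasFDerivAt_id z)
    have e4 := e2.clm_apply (hasFDerivAt_const (EuclideanSpace.single i (1 : ℝ)) z)
    have e5 : HasFDerivAt (fun z : EuclideanSpace ℝ (Fin n) => z i)
        (EuclideanSpace.proj (𝕜 := ℝ) i) z := (EuclideanSpace.proj (𝕜 := ℝ) i).hasFDerivAt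
    have e6 : HasFDerivAt (u i) _ z := e1.mul ((e5.mul e3).sub e4)
    rw [e6.fderiv]
    simp [EuclideanSpace.inner_single_right]
    ring
  have hsum : ∑ i, ∫ z, fderiv ℝ (u i) z (EuclideanSpace.single i 1) = 0 :=
    Finset.sum_eq_zero fun i _ => integral_fderiv_apply_eq_zero volume (huc i) (hus i) _
  rw [← integral_finsetSum] at hsum
  · rw [← hsum]
    congr 1 with z
    simp_rw [hd]
    have s1 : ∑ i, z i * z i = ‖z‖ ^ 2 := by
      rw [EuclideanSpace.norm_sq_eq]
      simp [pow_two]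
    have s2 := sum_coord_mul_clm (fderiv ℝ g z) z
    have s3 := sum_coord_mul_clm ((fderiv ℝ (fderiv ℝ g) z).flip z) z
    simp only [ContinuousLinearMap.flip_apply] at s3
    have : ∀ i, -2 * ρ' (1 - ‖z‖ ^ 2) * z i *
        (z i * fderiv ℝ g z z - fderiv ℝ g z (EuclideanSpace.single i 1)) +
      ρ (1 - ‖z‖ ^ 2) * (fderiv ℝ g z z +
        z i * (fderiv ℝ (fderiv ℝ g) z (EuclideanSpace.single i 1) z +
          fderiv ℝ g z (EuclideanSpace.single i 1)) -
        fderiv ℝ (fderiv ℝ g) z (EuclideanSpace.single i 1) (EuclideanSpace.single i 1)) =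
      -2 * ρ' (1 - ‖z‖ ^ 2) * fderiv ℝ g z z * (z i * z i) +
      2 * ρ' (1 - ‖z‖ ^ 2) * (z i * fderiv ℝ g z (EuclideanSpace.single i 1)) +
      ρ (1 - ‖z‖ ^ 2) * fderiv ℝ g z z +
      ρ (1 - ‖z‖ ^ 2) * (z i * fderiv ℝ (fderiv ℝ g) z (EuclideanSpace.single i 1) z) +
      ρ (1 - ‖z‖ ^ 2) * (z i * fderiv ℝ g z (EuclideanSpace.single i 1)) -
      ρ (1 - ‖z‖ ^ 2) *
        fderiv ℝ (fderiv ℝ g) z (EuclideanSpace.single i 1) (EuclideanSpace.single i 1) :=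
      fun i => by ring
    simp_rw [this, Finset.sum_sub_distrib, Finset.sum_add_distrib, ← Finset.mul_sum, s1, s2, s3]
    simp
    ring
  · intro i _
    exact (((huc i).continuous_fderiv one_ne_zero).clm_apply
      continuous_const).integrable_of_hasCompactSupport ((hus i).fderiv_apply ℝ _)

/-- The divergence identity for the weight `(1 - |z|²)^{-1/2}`, obtained from its regularisations
`ρ_ε` by dominated convergence. In the limit `2 q ρ_ε'(q) → -q^{-1/2}`, which lowers the
coefficient of `z · ∇g` from `n + 1` to `n`. -/
theorem integral_inv_sqrt_mul_eq_zero
    (hw : IntegrableOn (fun z : EuclideanSpace ℝ (Fin n) => 1 / √(1 - ‖z‖ ^ 2)) (Metric.ball 0 1))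
    {g : EuclideanSpace ℝ (Fin n) → ℝ} (hg : ContDiff ℝ 2 g) :
    ∫ z : EuclideanSpace ℝ (Fin n) in Metric.ball 0 1, 1 / √(1 - ‖z‖ ^ 2) *
      (fderiv ℝ (fderiv ℝ g) z z z + n * fderiv ℝ g z z -
        ∑ i, fderiv ℝ (fderiv ℝ g) z (EuclideanSpace.single i 1) (EuclideanSpace.single i 1)) =
      0 := by
  have hg1 : ContDiff ℝ 1 (fderiv ℝ g) := hg.fderiv_right (by norm_num)
  have c1 : Continuous (fderiv ℝ g) := hg1.continuous
  have c2 : Continuous (fderiv ℝ (fderiv ℝ g)) := hg1.continuous_fderiv one_ne_zero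
  set b : EuclideanSpace ℝ (Fin n) → ℝ := fun z => fderiv ℝ g z z with hb
  set a : EuclideanSpace ℝ (Fin n) → ℝ := fun z =>
    (n + 1) * fderiv ℝ g z z + fderiv ℝ (fderiv ℝ g) z z z -
        ∑ i, fderiv ℝ (fderiv ℝ g) z (EuclideanSpace.single i 1) (EuclideanSpace.single i 1)
    with ha
  have cb : Continuous b := by fun_prop
  have ca : Continuous a := by fun_prop
  obtain ⟨A, hA⟩ := (isCompact_closedBall (0 : EuclideanSpace ℝ (Fin n)) 1)
    |>.exists_bound_of_continuousOn ca.continuousOn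
  obtain ⟨B, hB⟩ := (isCompact_closedBall (0 : EuclideanSpace ℝ (Fin n)) 1)
    |>.exists_bound_of_continuousOn cb.continuousOn
  have hq : ∀ z ∈ Metric.ball (0 : EuclideanSpace ℝ (Fin n)) 1, 0 < 1 - ‖z‖ ^ 2 := by
    intro z hz
    rw [mem_ball_zero_iff] at hz
    nlinarith [norm_nonneg z]
  have hzero : ∀ ε : ℝ, 0 < ε → ∫ z in Metric.ball (0 : EuclideanSpace ℝ (Fin n)) 1,
      (regInvSqrt ε (1 - ‖z‖ ^ 2) * a z +
        2 * ((1 - ‖z‖ ^ 2) * regInvSqrtDeriv ε (1 - ‖z‖ ^ 2)) * b z) = 0 := by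
    intro ε hε
    rw [setIntegral_eq_integral_of_forall_compl_eq_zero]
    · exact integral_divergence_radial hg (hasDerivAt_regInvSqrt hε)
        (continuous_regInvSqrtDeriv hε) fun q => regInvSqrt_of_nonpos ε
    · intro z hz
      have : 1 - ‖z‖ ^ 2 ≤ 0 := by
        rw [mem_ball_zero_iff, not_lt] at hz
        nlinarith
      simp [regInvSqrt_of_nonpos ε this, regInvSqrtDeriv_of_nonpos ε this]
  have hlim := tendsto_integral_filter_of_dominated_convergence
    (μ := volume.restrict (Metric.ball (0 : EuclideanSpace ℝ (Fin n)) 1)) (l := 𝓝[>] (0 : ℝ))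
    (F := fun ε z => regInvSqrt ε (1 - ‖z‖ ^ 2) * a z +
        2 * ((1 - ‖z‖ ^ 2) * regInvSqrtDeriv ε (1 - ‖z‖ ^ 2)) * b z)
    (f := fun z => 1 / √(1 - ‖z‖ ^ 2) * a z + 2 * (-(1 / 2) * (1 / √(1 - ‖z‖ ^ 2))) * b z)
    (fun z => (A + 4 * B) * (1 / √(1 - ‖z‖ ^ 2))) ?_ ?_ (hw.const_mul _) ?_
  · have h0 : Tendsto (fun _ : ℝ => (0 : ℝ)) (𝓝[>] 0) (𝓝 0) := tendsto_const_nhds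
    have := tendsto_nhds_unique (hlim.congr' (by
      filter_upwards [self_mem_nhdsWithin] with ε hε using hzero ε hε)) h0
    rw [← this]
    congr 1 with z
    simp only [ha, hb]
    ring
  · filter_upwards [self_mem_nhdsWithin] with ε hε
    have d1 : Continuous (regInvSqrt ε) :=
      continuous_iff_continuousAt.2 fun q => (hasDerivAt_regInvSqrt hε q).continuousAt
    have d2 := continuous_regInvSqrtDeriv hε
    exact Continuous.aestronglyMeasurable (by fun_prop)
  · filter_upwards [self_mem_nhdsWithin] with ε hε
    filter_upwards [ae_restrict_mem measurableSet_ball] with z hz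
    have h1 := regInvSqrt_le hε (hq z hz)
    have h2 := abs_mul_regInvSqrtDeriv_le hε (hq z hz)
    have h3 := hA z (Metric.ball_subset_closedBall hz)
    have h4 := hB z (Metric.ball_subset_closedBall hz)
    rw [Real.norm_eq_abs] at h3 h4 ⊢
    refine (abs_add_le _ _).trans ?_
    rw [abs_mul, abs_mul, abs_mul, abs_two, abs_of_nonneg (regInvSqrt_nonneg hε _)]
    have h5 := mul_le_mul h1 h3 (abs_nonneg _) (by positivity)
    have h6 := mul_le_mul h2 h4 (abs_nonneg _) (by positivity)
    linarith
  · filter_upwards [ae_restrict_mem measurableSet_ball] with z hz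
    exact ((tendsto_regInvSqrt (hq z hz)).mul_const _).add
      (((tendsto_mul_regInvSqrtDeriv (hq z hz)).const_mul 2).mul_const _)

end Divergence

/-! ### Weighted means over balls -/

section BallMeasure

variable {n : ℕ}

/-- The measure `(1 - |z|²)^{-1/2} dz` on the open unit ball. -/
noncomputable def ballMeasure (n : ℕ) : Measure (EuclideanSpace ℝ (Fin n)) :=
  (volume.restrict (Metric.ball 0 1)).withDensity fun z => ENNReal.ofReal (1 / √(1 - ‖z‖ ^ 2))

theorem ae_ballMeasure_mem :
    ∀ᵐ z ∂ballMeasure n, z ∈ Metric.closedBall (0 : EuclideanSpace ℝ (Fin n)) 1 :=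
  (withDensity_absolutelyContinuous _ _).ae_le <| by
    filter_upwards [ae_restrict_mem measurableSet_ball] with z hz
    exact Metric.ball_subset_closedBall hz

theorem measurable_inv_sqrt_one_sub_norm_sq :
    Measurable fun z : EuclideanSpace ℝ (Fin n) => 1 / √(1 - ‖z‖ ^ 2) :=
  measurable_const.div (Continuous.measurable (by fun_prop))

theorem integral_ballMeasure (h : EuclideanSpace ℝ (Fin n) → ℝ) :
    ∫ z, h z ∂ballMeasure n = ∫ z in Metric.ball 0 1, 1 / √(1 - ‖z‖ ^ 2) * h z := by
  rw [ballMeasure, integral_withDensity_eq_integral_toReal_smul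
    measurable_inv_sqrt_one_sub_norm_sq.ennreal_ofReal (by simp)]
  congr 1 with z
  rw [ENNReal.toReal_ofReal (by positivity), smul_eq_mul]

instance isFiniteMeasure_ballMeasure (k : ℕ) : IsFiniteMeasure (ballMeasure (2 * k + 2)) :=
  isFiniteMeasure_withDensity_ofReal (integrableOn_ball_inv_sqrt k).2

theorem integrable_ballMeasure_of_continuous {k : ℕ} {h : EuclideanSpace ℝ (Fin (2 * k + 2)) → ℝ}
    (hh : Continuous h) : Integrable h (ballMeasure (2 * k + 2)) :=
  Continuous.integrable_of_ae_mem_compact (isCompact_closedBall _ _) ae_ballMeasure_mem hh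

/-- The integral `∫_{|z| < 1} f(x + t z) (1 - |z|²)^{-1/2} dz` as a function of `(x, t)`, for all
real `t`. -/
noncomputable def ballMean (f : EuclideanSpace ℝ (Fin n) → ℝ)
    (p : EuclideanSpace ℝ (Fin n) × ℝ) : ℝ :=
  ∫ z, f (p.1 + p.2 • z) ∂ballMeasure n

/-- The time derivative of a function on space-time. -/
noncomputable def timeDeriv (K : EuclideanSpace ℝ (Fin n) × ℝ → ℝ)
    (p : EuclideanSpace ℝ (Fin n) × ℝ) : ℝ :=
  fderiv ℝ K p (0, 1)

/-- The Laplacian in the space variables of a function on space-time. -/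
noncomputable def spaceLaplacian (K : EuclideanSpace ℝ (Fin n) × ℝ → ℝ)
    (p : EuclideanSpace ℝ (Fin n) × ℝ) : ℝ :=
  ∑ i, fderiv ℝ (fun q => fderiv ℝ K q (EuclideanSpace.single i 1, 0)) p
    (EuclideanSpace.single i 1, 0)

end BallMeasure

section BallMean

variable {k : ℕ} {f : EuclideanSpace ℝ (Fin (2 * k + 2)) → ℝ}

theorem contDiff_add_smul {E : Type} [NormedAddCommGroup E] [NormedSpace ℝ E] {m : WithTop ℕ∞} :
    ContDiff ℝ m fun q : (E × ℝ) × E => q.1.1 + q.1.2 • q.2 := by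
  fun_prop

theorem contDiff_ballMean {j : ℕ} (hf : ContDiff ℝ j f) : ContDiff ℝ j (ballMean f) :=
  contDiff_integral_of_ae_mem_compact (isCompact_closedBall _ _) ae_ballMeasure_mem j
    (Φ := fun q : (EuclideanSpace ℝ (Fin (2 * k + 2)) × ℝ) × EuclideanSpace ℝ (Fin (2 * k + 2)) =>
      f (q.1.1 + q.1.2 • q.2)) (hf.comp contDiff_add_smul)

theorem fderiv_add_smul_apply {E : Type} [NormedAddCommGroup E] [NormedSpace ℝ E]
    (p v : E × ℝ) (z : E) :
    fderiv ℝ (fun q : (E × ℝ) × E => q.1.1 + q.1.2 • q.2) (p, z) (v, 0) = v.1 + v.2 • z := by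
  have h1 : HasFDerivAt (fun q : (E × ℝ) × E => q.1.1 + q.1.2 • q.2) _ (p, z) :=
    (hasFDerivAt_fst (𝕜 := ℝ) (p := (p, z))).fst.add
      ((hasFDerivAt_fst (𝕜 := ℝ) (p := (p, z))).snd.smul (hasFDerivAt_snd (𝕜 := ℝ) (p := (p, z))))
  rw [h1.fderiv]
  simp

theorem fderiv_ballMean (hf : ContDiff ℝ 1 f) (p v : EuclideanSpace ℝ (Fin (2 * k + 2)) × ℝ) :
    fderiv ℝ (ballMean f) p v =
      ∫ z, fderiv ℝ f (p.1 + p.2 • z) (v.1 + v.2 • z) ∂ballMeasure (2 * k + 2) := by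
  have := fderiv_integral_apply (isCompact_closedBall (0 : EuclideanSpace ℝ (Fin (2 * k + 2))) 1)
    ae_ballMeasure_mem (Φ := fun q => f (q.1.1 + q.1.2 • q.2)) (hf.comp contDiff_add_smul) p v
  refine this.trans (integral_congr_ae (Eventually.of_forall fun z => ?_))
  have h1 := fderiv_comp (p, z)
    (g := f) (f := fun q : (EuclideanSpace ℝ (Fin (2 * k + 2)) × ℝ) ×
      EuclideanSpace ℝ (Fin (2 * k + 2)) => q.1.1 + q.1.2 • q.2)
    (hf.differentiable one_ne_zero _) (contDiff_add_smul.differentiable one_ne_zero _)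
  simp only [Function.comp_def] at h1
  simp only [h1, ContinuousLinearMap.comp_apply, fderiv_add_smul_apply]

theorem fderiv_fderiv_ballMean (hf : ContDiff ℝ 2 f)
    (p v : EuclideanSpace ℝ (Fin (2 * k + 2)) × ℝ) :
    fderiv ℝ (fun q => fderiv ℝ (ballMean f) q v) p v =
      ∫ z, fderiv ℝ (fderiv ℝ f) (p.1 + p.2 • z) (v.1 + v.2 • z) (v.1 + v.2 • z)
        ∂ballMeasure (2 * k + 2) := by
  have hf1 : ContDiff ℝ 1 f := hf.of_le one_le_two
  have hf2 : ContDiff ℝ 1 (fderiv ℝ f) := hf.fderiv_right (by norm_num)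
  simp_rw [fderiv_ballMean hf1]
  have hd : ContDiff ℝ 1 fun q : (EuclideanSpace ℝ (Fin (2 * k + 2)) × ℝ) ×
      EuclideanSpace ℝ (Fin (2 * k + 2)) => v.1 + v.2 • q.2 :=
    contDiff_const.add (contDiff_snd.const_smul v.2)
  have hc := hf2.comp (contDiff_add_smul (E := EuclideanSpace ℝ (Fin (2 * k + 2))))
  have := fderiv_integral_apply (isCompact_closedBall (0 : EuclideanSpace ℝ (Fin (2 * k + 2))) 1)
    ae_ballMeasure_mem (Φ := fun q => fderiv ℝ f (q.1.1 + q.1.2 • q.2) (v.1 + v.2 • q.2))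
    (hc.clm_apply hd) p v
  refine this.trans (integral_congr_ae (Eventually.of_forall fun z => ?_))
  have h1 := fderiv_comp (p, z)
    (g := fderiv ℝ f) (f := fun q : (EuclideanSpace ℝ (Fin (2 * k + 2)) × ℝ) ×
      EuclideanSpace ℝ (Fin (2 * k + 2)) => q.1.1 + q.1.2 • q.2)
    (hf2.differentiable one_ne_zero _) (contDiff_add_smul.differentiable one_ne_zero _)
  have h2 : HasFDerivAt (fun q : (EuclideanSpace ℝ (Fin (2 * k + 2)) × ℝ) ×
      EuclideanSpace ℝ (Fin (2 * k + 2)) =>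
      fderiv ℝ f (q.1.1 + q.1.2 • q.2) (v.1 + v.2 • q.2)) _ (p, z) :=
    (hc.differentiable one_ne_zero (p, z)).hasFDerivAt.clm_apply
      (((hasFDerivAt_snd (𝕜 := ℝ) (p := (p, z))).const_smul v.2).const_add v.1)
  simp only [h2.fderiv, h1]
  simp [fderiv_add_smul_apply]
  ring

/-- The Euler–Poisson–Darboux equation `t F_tt + n F_t = t ΔF`, which is the divergence identity for
`g(z) = f(x + t z)`. -/
theorem ballMean_eulerPoissonDarboux (hf : ContDiff ℝ 2 f)
    {p : EuclideanSpace ℝ (Fin (2 * k + 2)) × ℝ} (hp : 0 < p.2) :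
    p.2 * timeDeriv (timeDeriv (ballMean f)) p + ((2 * k + 2 : ℕ) : ℝ) * timeDeriv (ballMean f) p =
      p.2 * spaceLaplacian (ballMean f) p := by
  have hf1 : ContDiff ℝ 1 f := hf.of_le one_le_two
  have hf2 : ContDiff ℝ 1 (fderiv ℝ f) := hf.fderiv_right (by norm_num)
  have c1 : Continuous (fderiv ℝ f) := hf2.continuous
  have c2 : Continuous (fderiv ℝ (fderiv ℝ f)) := hf2.continuous_fderiv one_ne_zero
  have hg : ContDiff ℝ 2 fun z => f (p.1 + p.2 • z) :=
    hf.comp (contDiff_const.add (contDiff_id.const_smul p.2))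
  have hl : ∀ z : EuclideanSpace ℝ (Fin (2 * k + 2)), HasFDerivAt
      (fun z : EuclideanSpace ℝ (Fin (2 * k + 2)) => p.1 + p.2 • z)
      (p.2 • ContinuousLinearMap.id ℝ (EuclideanSpace ℝ (Fin (2 * k + 2)))) z := fun z =>
    ((hasFDerivAt_id z).const_smul p.2).const_add p.1
  have e1 : (fderiv ℝ fun z => f (p.1 + p.2 • z)) =
      fun z => p.2 • fderiv ℝ f (p.1 + p.2 • z) := by
    ext1 z
    have : HasFDerivAt (fun z => f (p.1 + p.2 • z)) _ z :=
      (hf1.differentiable one_ne_zero (p.1 + p.2 • z)).hasFDerivAt.comp z (hl z)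
    rw [this.fderiv]
    ext v
    simp
  have e2 : ∀ z, fderiv ℝ (fderiv ℝ fun z => f (p.1 + p.2 • z)) z =
      p.2 ^ 2 • fderiv ℝ (fderiv ℝ f) (p.1 + p.2 • z) := by
    intro z
    rw [e1]
    have : HasFDerivAt (fun z => p.2 • fderiv ℝ f (p.1 + p.2 • z)) _ z :=
      ((hf2.differentiable one_ne_zero (p.1 + p.2 • z)).hasFDerivAt.comp z (hl z)).const_smul p.2
    rw [this.fderiv]
    ext v w
    simp
    ring
  have key := integral_inv_sqrt_mul_eq_zero (integrableOn_ball_inv_sqrt k) hg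
  rw [← integral_ballMeasure (fun z => fderiv ℝ (fderiv ℝ fun z => f (p.1 + p.2 • z)) z z z +
      ((2 * k + 2 : ℕ) : ℝ) * fderiv ℝ (fun z => f (p.1 + p.2 • z)) z z -
      ∑ i, fderiv ℝ (fderiv ℝ fun z => f (p.1 + p.2 • z)) z (EuclideanSpace.single i 1)
        (EuclideanSpace.single i 1))] at key
  simp only [e2] at key
  simp only [e1, smul_apply, smul_eq_mul, ← Finset.mul_sum] at key
  rw [integral_sub (integrable_ballMeasure_of_continuous (by fun_prop))
      (integrable_ballMeasure_of_continuous (by fun_prop)),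
    integral_add (integrable_ballMeasure_of_continuous (by fun_prop))
      (integrable_ballMeasure_of_continuous (by fun_prop)), integral_const_mul, integral_const_mul,
      integral_const_mul, integral_const_mul, integral_finsetSum _ fun i _ =>
      integrable_ballMeasure_of_continuous (by fun_prop)] at key
  have d1 : timeDeriv (ballMean f) p = ∫ z, fderiv ℝ f (p.1 + p.2 • z) z ∂ballMeasure _ := by
    simp [timeDeriv, fderiv_ballMean hf1]
  have d2 : timeDeriv (timeDeriv (ballMean f)) p =
      ∫ z, fderiv ℝ (fderiv ℝ f) (p.1 + p.2 • z) z z ∂ballMeasure _ := by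
    exact (fderiv_fderiv_ballMean hf p (0, 1)).trans (by simp)
  have d3 : spaceLaplacian (ballMean f) p = ∑ i, ∫ z, fderiv ℝ (fderiv ℝ f) (p.1 + p.2 • z)
      (EuclideanSpace.single i 1) (EuclideanSpace.single i 1) ∂ballMeasure _ := by
    unfold spaceLaplacian
    simp [fderiv_fderiv_ballMean hf]
  rw [d1, d2, d3]
  refine mul_left_cancel₀ hp.ne' ?_
  linear_combination key

end BallMean

/-! ### Functions on space-time -/

section SpaceTime

variable {n : ℕ}

theorem ContDiff.fderiv_apply_const_nat {P : Type} [NormedAddCommGroup P] [NormedSpace ℝ P]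
    {j : ℕ} {K : P → ℝ} (hK : ContDiff ℝ (j + 1 : ℕ) K) (v : P) :
    ContDiff ℝ j fun p => fderiv ℝ K p v :=
  (hK.fderiv_right (m := j) (by exact_mod_cast le_rfl)).clm_apply contDiff_const

theorem ContDiff.differentiable_fderiv_apply_const {P : Type} [NormedAddCommGroup P]
    [NormedSpace ℝ P] {K : P → ℝ} (hK : ContDiff ℝ 2 K) (v : P) :
    Differentiable ℝ fun p => fderiv ℝ K p v :=
  ContDiff.differentiable (n := (1 : ℕ))
    (ContDiff.fderiv_apply_const_nat (by exact_mod_cast hK) v) (by norm_num)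

theorem fderiv_fderiv_apply_comm {P : Type} [NormedAddCommGroup P] [NormedSpace ℝ P]
    {K : P → ℝ} (hK : ContDiff ℝ 2 K) (p v w : P) :
    fderiv ℝ (fun q => fderiv ℝ K q v) p w = fderiv ℝ (fun q => fderiv ℝ K q w) p v := by
  have h1 : DifferentiableAt ℝ (fderiv ℝ K) p :=
    (hK.fderiv_right (m := 1) (by norm_num)).differentiable one_ne_zero p
  have h2 : ∀ u, fderiv ℝ (fun q => fderiv ℝ K q u) p = (fderiv ℝ (fderiv ℝ K) p).flip u := by
    intro u
    have := (h1.hasFDerivAt.clm_apply (hasFDerivAt_const u p)).fderiv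
    simpa using this
  rw [h2, h2]
  exact (hK.contDiffAt.isSymmSndFDerivAt (by simp)) w v

variable {K A B : EuclideanSpace ℝ (Fin n) × ℝ → ℝ}

theorem contDiff_timeDeriv {j : ℕ} (hK : ContDiff ℝ (j + 1 : ℕ) K) :
    ContDiff ℝ j (timeDeriv K) :=
  hK.fderiv_apply_const_nat _

theorem contDiff_spaceLaplacian {j : ℕ} (hK : ContDiff ℝ (j + 2 : ℕ) K) :
    ContDiff ℝ j (spaceLaplacian K) :=
  ContDiff.sum fun _ _ => (hK.fderiv_apply_const_nat _).fderiv_apply_const_nat _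

theorem hasDerivAt_timeDeriv (hK : Differentiable ℝ K) (x : EuclideanSpace ℝ (Fin n)) (t : ℝ) :
    HasDerivAt (fun s => K (x, s)) (timeDeriv K (x, t)) t := by
  have := (hK (x, t)).hasFDerivAt.comp_hasDerivAt t
    ((hasDerivAt_const t x).prodMk (hasDerivAt_id t))
  exact this

theorem timeDeriv_spaceLaplacian (hK : ContDiff ℝ 3 K) (p : EuclideanSpace ℝ (Fin n) × ℝ) :
    timeDeriv (spaceLaplacian K) p = spaceLaplacian (timeDeriv K) p := by
  have hK' : ContDiff ℝ ((2 + 1 : ℕ) : WithTop ℕ∞) K := by exact_mod_cast hK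
  unfold timeDeriv spaceLaplacian
  rw [fderiv_fun_sum]
  · rw [_root_.sum_apply]
    refine Finset.sum_congr rfl fun i _ => ?_
    rw [fderiv_fderiv_apply_comm (hK'.fderiv_apply_const_nat _)]
    congr 2
    ext1 q
    exact fderiv_fderiv_apply_comm (hK.of_le (by norm_num)) _ _ _
  · intro i _
    have h1 : ContDiff ℝ ((1 + 1 : ℕ) : WithTop ℕ∞)
      (fun q => fderiv ℝ K q (EuclideanSpace.single i 1, 0)) := hK'.fderiv_apply_const_nat _
    exact (h1.fderiv_apply_const_nat _).differentiable (by norm_num) p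

theorem fderiv_snd_mul_add (hA : Differentiable ℝ A) (hB : Differentiable ℝ B) (c : ℝ)
    (p v : EuclideanSpace ℝ (Fin n) × ℝ) :
    fderiv ℝ (fun p => p.2 * A p + c * B p) p v =
      p.2 * fderiv ℝ A p v + v.2 * A p + c * fderiv ℝ B p v := by
  have := (((hasFDerivAt_snd (𝕜 := ℝ) (p := p)).mul (hA p).hasFDerivAt).add
    ((hB p).hasFDerivAt.const_mul c)).fderiv
  have h2 : fderiv ℝ (fun p => p.2 * A p + c * B p) p = _ := this
  rw [h2]
  simp
  ring

theorem timeDeriv_snd_mul_add (hA : Differentiable ℝ A) (hB : Differentiable ℝ B) (c : ℝ)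
    (p : EuclideanSpace ℝ (Fin n) × ℝ) :
    timeDeriv (fun p => p.2 * A p + c * B p) p =
      p.2 * timeDeriv A p + A p + c * timeDeriv B p := by
  unfold timeDeriv
  rw [fderiv_snd_mul_add hA hB]
  simp

theorem spaceLaplacian_snd_mul_add (hA : ContDiff ℝ 2 A) (hB : ContDiff ℝ 2 B) (c : ℝ)
    (p : EuclideanSpace ℝ (Fin n) × ℝ) :
    spaceLaplacian (fun p => p.2 * A p + c * B p) p =
      p.2 * spaceLaplacian A p + c * spaceLaplacian B p := by
  unfold spaceLaplacian
  simp_rw [fderiv_snd_mul_add (hA.differentiable two_ne_zero) (hB.differentiable two_ne_zero),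
    zero_mul, add_zero, fderiv_snd_mul_add (hA.differentiable_fderiv_apply_const _)
      (hB.differentiable_fderiv_apply_const _), zero_mul, add_zero,
    Finset.sum_add_distrib, Finset.mul_sum]

theorem fderiv_const_mul_add (hA : Differentiable ℝ A) (hB : Differentiable ℝ B) (a b : ℝ)
    (p v : EuclideanSpace ℝ (Fin n) × ℝ) :
    fderiv ℝ (fun p => a * A p + b * B p) p v = a * fderiv ℝ A p v + b * fderiv ℝ B p v := by
  have : fderiv ℝ (fun p => a * A p + b * B p) p = _ :=
    (((hA p).hasFDerivAt.const_mul a).add ((hB p).hasFDerivAt.const_mul b)).fderiv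
  rw [this]
  simp

theorem timeDeriv_const_mul_add (hA : Differentiable ℝ A) (hB : Differentiable ℝ B) (a b : ℝ) :
    timeDeriv (fun p => a * A p + b * B p) = fun p => a * timeDeriv A p + b * timeDeriv B p :=
  funext fun p => fderiv_const_mul_add hA hB a b p _

theorem spaceLaplacian_const_mul_add (hA : ContDiff ℝ 2 A) (hB : ContDiff ℝ 2 B) (a b : ℝ)
    (p : EuclideanSpace ℝ (Fin n) × ℝ) :
    spaceLaplacian (fun p => a * A p + b * B p) p =
      a * spaceLaplacian A p + b * spaceLaplacian B p := by
  unfold spaceLaplacian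
  simp_rw [fderiv_const_mul_add (hA.differentiable two_ne_zero) (hB.differentiable two_ne_zero),
    fderiv_const_mul_add (hA.differentiable_fderiv_apply_const _)
      (hB.differentiable_fderiv_apply_const _), Finset.sum_add_distrib, Finset.mul_sum]

theorem laplacian_slice_eq_spaceLaplacian (hK : ContDiff ℝ 2 K) (x : EuclideanSpace ℝ (Fin n))
    (t : ℝ) : Δ (fun y => K (y, t)) x = spaceLaplacian K (x, t) := by
  have slice : ∀ {K : EuclideanSpace ℝ (Fin n) × ℝ → ℝ}, Differentiable ℝ K → ∀ y v,
      fderiv ℝ (fun y => K (y, t)) y v = fderiv ℝ K (y, t) (v, 0) := by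
    intro K hK y v
    have := (HasFDerivAt.comp y (hK (y, t)).hasFDerivAt
      (hasFDerivAt_prodMk_left (𝕜 := ℝ) y t)).fderiv
    have h2 : fderiv ℝ (fun y => K (y, t)) y = _ := this
    rw [h2]
    simp
  have hs : ContDiff ℝ 2 fun y => K (y, t) := hK.comp (contDiff_prodMk_left t)
  rw [InnerProductSpace.laplacian_eq_iteratedFDeriv_orthonormalBasis _
    (EuclideanSpace.basisFun (Fin n) ℝ)]
  unfold spaceLaplacian
  refine Finset.sum_congr rfl fun i _ => ?_
  have h1 : DifferentiableAt ℝ (fderiv ℝ fun y => K (y, t)) x :=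
    (hs.fderiv_right (m := 1) (by norm_num)).differentiable one_ne_zero x
  have h2 := (h1.hasFDerivAt.clm_apply
    (hasFDerivAt_const (EuclideanSpace.single i (1 : ℝ)) x)).fderiv
  have h3 : (fun y => fderiv ℝ (fun y => K (y, t)) y (EuclideanSpace.single i 1)) =
      fun y => fderiv ℝ K (y, t) (EuclideanSpace.single i 1, 0) :=
    funext fun y => slice (hK.differentiable two_ne_zero) y _
  rw [iteratedFDeriv_two_apply, ← slice (hK.differentiable_fderiv_apply_const _) x, ← h3, h2]
  simp

/-! ### The Euler–Poisson–Darboux equation -/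

/-- The operator `t ∂_t + (c - 1)`, which turns solutions of `t H_tt + c H_t = t ΔH` into
solutions of the same equation with `c - 2` in place of `c`. -/
noncomputable def darbouxStep (c : ℝ) (H : EuclideanSpace ℝ (Fin n) × ℝ → ℝ)
    (p : EuclideanSpace ℝ (Fin n) × ℝ) : ℝ :=
  p.2 * timeDeriv H p + (c - 1) * H p

theorem contDiff_darbouxStep {j : ℕ} {H : EuclideanSpace ℝ (Fin n) × ℝ → ℝ} (c : ℝ)
    (hH : ContDiff ℝ (j + 1 : ℕ) H) : ContDiff ℝ j (darbouxStep c H) :=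
  (contDiff_snd.mul (contDiff_timeDeriv hH)).add
    (contDiff_const.mul (hH.of_le (by exact_mod_cast Nat.le_succ j)))

theorem timeDeriv_congr {p : EuclideanSpace ℝ (Fin n) × ℝ} (hp : 0 < p.2)
    (h : ∀ q : EuclideanSpace ℝ (Fin n) × ℝ, 0 < q.2 → A q = B q) :
    timeDeriv A p = timeDeriv B p := by
  have : A =ᶠ[𝓝 p] B := by
    filter_upwards [(isOpen_Ioi.preimage continuous_snd).mem_nhds hp] with q hq using h q hq
  unfold timeDeriv
  rw [this.fderiv_eq]

/-- With `H' = t H_t + (c - 1) H` the equation gives `H'_t = t ΔH`, and one more time derivative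
gives the equation for `H'`. -/
theorem darbouxStep_eulerPoissonDarboux {c : ℝ} {H : EuclideanSpace ℝ (Fin n) × ℝ → ℝ}
    (hH : ContDiff ℝ 3 H)
    (h : ∀ p : EuclideanSpace ℝ (Fin n) × ℝ, 0 < p.2 →
      p.2 * timeDeriv (timeDeriv H) p + c * timeDeriv H p = p.2 * spaceLaplacian H p)
    {p : EuclideanSpace ℝ (Fin n) × ℝ} (hp : 0 < p.2) :
    p.2 * timeDeriv (timeDeriv (darbouxStep c H)) p + (c - 2) * timeDeriv (darbouxStep c H) p =
      p.2 * spaceLaplacian (darbouxStep c H) p := by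
  have hH1 : ContDiff ℝ 2 (timeDeriv H) := contDiff_timeDeriv (j := 2) (by exact_mod_cast hH)
  have hH2 : ContDiff ℝ 2 H := hH.of_le (by norm_num)
  have d0 : Differentiable ℝ H := hH2.differentiable two_ne_zero
  have d1 : Differentiable ℝ (timeDeriv H) := hH1.differentiable two_ne_zero
  have dL : Differentiable ℝ (spaceLaplacian H) :=
    ContDiff.differentiable (n := (1 : ℕ)) (contDiff_spaceLaplacian (by exact_mod_cast hH))
      (by norm_num)
  have e1 : ∀ q : EuclideanSpace ℝ (Fin n) × ℝ, 0 < q.2 →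
      timeDeriv (darbouxStep c H) q = q.2 * spaceLaplacian H q + 0 * H q := by
    intro q hq
    rw [← h q hq]
    unfold darbouxStep
    rw [timeDeriv_snd_mul_add d1 d0]
    ring
  rw [timeDeriv_congr hp e1, e1 p hp, timeDeriv_snd_mul_add dL d0, timeDeriv_spaceLaplacian hH]
  unfold darbouxStep
  rw [spaceLaplacian_snd_mul_add hH1 hH2]
  ring

end SpaceTime

section EvenDimension

variable {k : ℕ} {f : EuclideanSpace ℝ (Fin (2 * k + 2)) → ℝ}

/-- The functions obtained from `ballMean f` by applying `t ∂_t + (n - 1)`, `t ∂_t + (n - 3)`, … in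
turn. -/
noncomputable def darbouxIter (f : EuclideanSpace ℝ (Fin (2 * k + 2)) → ℝ) :
    ℕ → EuclideanSpace ℝ (Fin (2 * k + 2)) × ℝ → ℝ
  | 0 => ballMean f
  | j + 1 => darbouxStep (((2 * k + 2 : ℕ) : ℝ) - 2 * j) (darbouxIter f j)

theorem contDiff_darbouxIter (j : ℕ) {i : ℕ} (hf : ContDiff ℝ (i + j : ℕ) f) :
    ContDiff ℝ i (darbouxIter f j) := by
  induction j generalizing i with
  | zero => exact contDiff_ballMean hf
  | succ j ih => exact contDiff_darbouxStep _ (ih (by convert hf using 2; ring))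

theorem darbouxIter_eulerPoissonDarboux {j : ℕ} (hf : ContDiff ℝ (j + 2 : ℕ) f)
    {p : EuclideanSpace ℝ (Fin (2 * k + 2)) × ℝ} (hp : 0 < p.2) :
    p.2 * timeDeriv (timeDeriv (darbouxIter f j)) p +
        (((2 * k + 2 : ℕ) : ℝ) - 2 * j) * timeDeriv (darbouxIter f j) p =
      p.2 * spaceLaplacian (darbouxIter f j) p := by
  induction j generalizing p with
  | zero => simpa [darbouxIter] using ballMean_eulerPoissonDarboux (hf.of_le (by norm_num)) hp
  | succ j ih =>
    have h3 : ContDiff ℝ 3 (darbouxIter f j) := by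
      have := contDiff_darbouxIter j (i := 3) (f := f) (by convert hf using 2; ring)
      exact_mod_cast this
    have := darbouxStep_eulerPoissonDarboux h3 (fun q hq =>
      ih (hf.of_le (by exact_mod_cast (by omega))) hq) hp
    rw [← darbouxIter] at this
    rw [← this]
    push_cast
    ring

theorem darbouxIter_zero_time {j r : ℕ} (h : j + r = k) (x : EuclideanSpace ℝ (Fin (2 * k + 2))) :
    darbouxIter f j (x, 0) * (Nat.doubleFactorial (2 * r + 1) : ℝ) =
      (Nat.doubleFactorial (2 * k + 1) : ℝ) * ballMean f (x, 0) := by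
  induction j generalizing r with
  | zero =>
    obtain rfl : r = k := by omega
    rw [darbouxIter]
    ring
  | succ j ih =>
    rw [← ih (r := r + 1) (by omega), darbouxIter, darbouxStep,
      show 2 * (r + 1) + 1 = 2 * r + 1 + 2 by ring, Nat.doubleFactorial_add_two]
    have hk : (k : ℝ) = j + 1 + r := by exact_mod_cast h.symm
    push_cast
    rw [hk]
    ring

/-! ### The weighted integrals and the operator `t⁻¹ ∂_t` -/

/-- The rescaling `y = x + t z` of the weighted integrand, extended by `0` outside the ball. -/
theorem indicator_weight_add_smul (f : EuclideanSpace ℝ (Fin (2 * k + 2)) → ℝ)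
    (x : EuclideanSpace ℝ (Fin (2 * k + 2))) {t : ℝ} (ht : 0 < t)
    (z : EuclideanSpace ℝ (Fin (2 * k + 2))) :
    (Metric.ball x t).indicator (fun y => 1 / √(t ^ 2 - ‖x - y‖ ^ 2) * f y) (x + t • z) =
      t⁻¹ * (Metric.ball 0 1).indicator (fun z => 1 / √(1 - ‖z‖ ^ 2) * f (x + t • z)) z := by
  have h1 : x + t • z ∈ Metric.ball x t ↔ z ∈ Metric.ball 0 1 := by
    rw [mem_ball_iff_norm, add_sub_cancel_left, norm_smul, Real.norm_of_nonneg ht.le,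
      mem_ball_zero_iff]
    exact mul_lt_iff_lt_one_right ht
  by_cases hz : z ∈ Metric.ball 0 1
  · rw [indicator_of_mem (h1.2 hz), indicator_of_mem hz]
    have h2 : t ^ 2 - ‖x - (x + t • z)‖ ^ 2 = t ^ 2 * (1 - ‖z‖ ^ 2) := by
      rw [sub_add_cancel_left, norm_neg, norm_smul, Real.norm_of_nonneg ht.le]
      ring
    rw [h2, Real.sqrt_mul (sq_nonneg t), Real.sqrt_sq ht.le, one_div, one_div, mul_inv, mul_assoc]
  · rw [indicator_of_notMem (fun h => hz (h1.1 h)), indicator_of_notMem hz, mul_zero]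

theorem integrableOn_weight_mul {f : EuclideanSpace ℝ (Fin (2 * k + 2)) → ℝ} (hf : Continuous f)
    (x : EuclideanSpace ℝ (Fin (2 * k + 2))) {t : ℝ} (ht : 0 < t) :
    IntegrableOn (fun y => 1 / √(t ^ 2 - ‖x - y‖ ^ 2) * f y) (Metric.ball x t) := by
  rw [← integrable_indicator_iff measurableSet_ball,
    ← (measurePreserving_add_left volume x).integrable_comp_emb (measurableEmbedding_addLeft x),
    ← integrable_comp_smul_iff volume _ ht.ne']
  simp_rw [Function.comp_apply, indicator_weight_add_smul f x ht]
  refine Integrable.const_mul ?_ _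
  rw [integrable_indicator_iff measurableSet_ball]
  have hc : Continuous fun z => f (x + t • z) := by fun_prop
  obtain ⟨C, hC⟩ := (isCompact_closedBall (0 : EuclideanSpace ℝ (Fin (2 * k + 2))) 1)
    |>.exists_bound_of_continuousOn hc.continuousOn
  refine Integrable.mul_bdd (c := C) (integrableOn_ball_inv_sqrt k) hc.aestronglyMeasurable ?_
  filter_upwards [ae_restrict_mem measurableSet_ball] with z hz
  exact hC z (Metric.ball_subset_closedBall hz)

theorem weightedBallIntegral_eq_ballMean (f : EuclideanSpace ℝ (Fin (2 * k + 2)) → ℝ)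
    (x : EuclideanSpace ℝ (Fin (2 * k + 2))) {t : ℝ} (ht : 0 < t) :
    weightedBallIntegral t f x = t ^ (2 * k + 1) * ballMean f (x, t) := by
  rw [weightedBallIntegral, ballMean, integral_ballMeasure, ← integral_indicator measurableSet_ball,
    ← integral_indicator measurableSet_ball, ← integral_add_left_eq_self _ x]
  have h1 := Measure.integral_comp_smul (volume : Measure (EuclideanSpace ℝ (Fin (2 * k + 2))))
    (fun z => (Metric.ball x t).indicator (fun y => 1 / √(t ^ 2 - ‖x - y‖ ^ 2) * f y) (x + z)) t
  simp_rw [indicator_weight_add_smul f x ht] at h1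
  rw [integral_const_mul, finrank_euclideanSpace_fin, abs_of_pos (by positivity), smul_eq_mul,
    inv_mul_eq_iff_eq_mul₀ ht.ne', eq_comm, ← mul_assoc] at h1
  rw [← h1, ← mul_assoc]
  field_simp
  ring

theorem pow_mul_weightedBallMean (f : EuclideanSpace ℝ (Fin (2 * k + 2)) → ℝ)
    (x : EuclideanSpace ℝ (Fin (2 * k + 2))) {t : ℝ} (ht : 0 < t) :
    t ^ (2 * k + 2) * weightedBallMean t f x =
      (unitBallVolume (2 * k + 2))⁻¹ * (t ^ (2 * k + 1) * ballMean f (x, t)) := by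
  rw [weightedBallMean, weightedBallIntegral_eq_ballMean f x ht]
  field_simp

/-- Each `t⁻¹ ∂_t` is one Darboux step, as
`t⁻¹ ∂_t (t ^ (2r + 3) H) = t ^ (2r + 1) (t H_t + (2r + 3) H)`. -/
theorem iterate_invMulDeriv_eq {j r : ℕ} (h : j + r = k) (hf : ContDiff ℝ (j : ℕ) f)
    (x : EuclideanSpace ℝ (Fin (2 * k + 2))) {t : ℝ} (ht : 0 < t) :
    invMulDeriv^[j] (fun s => s ^ (2 * k + 2) * weightedBallMean s f x) t =
      (unitBallVolume (2 * k + 2))⁻¹ * (t ^ (2 * r + 1) * darbouxIter f j (x, t)) := by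
  induction j generalizing r t with
  | zero =>
    obtain rfl : r = k := by omega
    exact pow_mul_weightedBallMean f x ht
  | succ j ih =>
    have hd : Differentiable ℝ (darbouxIter f j) :=
      ContDiff.differentiable (n := (1 : ℕ))
        (contDiff_darbouxIter j (by convert hf using 2; ring)) (by norm_num)
    have hev : invMulDeriv^[j] (fun s => s ^ (2 * k + 2) * weightedBallMean s f x) =ᶠ[𝓝 t]
        fun s => (unitBallVolume (2 * k + 2))⁻¹ *
          (s ^ (2 * (r + 1) + 1) * darbouxIter f j (x, s)) := by
      filter_upwards [Ioi_mem_nhds ht] with s hs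
      exact ih (by omega) (hf.of_le (by exact_mod_cast Nat.le_succ j)) hs
    rw [Function.iterate_succ_apply', invMulDeriv, hev.deriv_eq,
      (((hasDerivAt_pow (2 * (r + 1) + 1) t).fun_mul (hasDerivAt_timeDeriv hd x t)).const_mul
        (unitBallVolume (2 * k + 2))⁻¹).deriv, darbouxIter, darbouxStep]
    have hk : (k : ℝ) = j + 1 + r := by exact_mod_cast h.symm
    push_cast
    rw [hk]
    generalize (unitBallVolume (2 * k + 2))⁻¹ = c
    field_simp
    ring

end EvenDimension

/-! ### Solution of the Cauchy problem -/

section VelocityWave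

variable {k : ℕ} {f : EuclideanSpace ℝ (Fin (2 * k + 2)) → ℝ}

/-- The function `t H(x, t)`, with `H` the `k`-th of the functions `darbouxIter f`. Up to a constant
factor it is the solution of the wave equation with initial value `0` and initial velocity `f`. -/
noncomputable def velocityWave (f : EuclideanSpace ℝ (Fin (2 * k + 2)) → ℝ)
    (p : EuclideanSpace ℝ (Fin (2 * k + 2)) × ℝ) : ℝ :=
  p.2 * darbouxIter f k p

theorem velocityWave_eq :
    velocityWave f = fun p => p.2 * darbouxIter f k p + 0 * darbouxIter f k p := by
  ext p
  simp [velocityWave]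

theorem contDiff_velocityWave {i : ℕ} (hf : ContDiff ℝ (i + k : ℕ) f) :
    ContDiff ℝ i (velocityWave f) :=
  contDiff_snd.mul (contDiff_darbouxIter k hf)

theorem timeDeriv_velocityWave (hf : ContDiff ℝ (1 + k : ℕ) f) :
    timeDeriv (velocityWave f) =
      fun p => p.2 * timeDeriv (darbouxIter f k) p + 1 * darbouxIter f k p := by
  have hd : Differentiable ℝ (darbouxIter f k) :=
    (contDiff_darbouxIter k hf).differentiable (by norm_num)
  ext p
  rw [velocityWave_eq, timeDeriv_snd_mul_add hd hd]
  ring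

theorem spaceLaplacian_velocityWave (hf : ContDiff ℝ (2 + k : ℕ) f)
    (p : EuclideanSpace ℝ (Fin (2 * k + 2)) × ℝ) :
    spaceLaplacian (velocityWave f) p = p.2 * spaceLaplacian (darbouxIter f k) p := by
  have h2 : ContDiff ℝ 2 (darbouxIter f k) := contDiff_darbouxIter k hf
  rw [velocityWave_eq, spaceLaplacian_snd_mul_add h2 h2]
  ring

/-- The Euler–Poisson–Darboux equation with `c = 2` for `H` is the wave equation for `t H`. The case
`t = 0` follows by continuity. -/
theorem velocityWave_wave_eq (hf : ContDiff ℝ (2 + k : ℕ) f)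
    {p : EuclideanSpace ℝ (Fin (2 * k + 2)) × ℝ} (hp : 0 ≤ p.2) :
    timeDeriv (timeDeriv (velocityWave f)) p = spaceLaplacian (velocityWave f) p := by
  have hpos : ∀ q : EuclideanSpace ℝ (Fin (2 * k + 2)) × ℝ, 0 < q.2 →
      timeDeriv (timeDeriv (velocityWave f)) q = spaceLaplacian (velocityWave f) q := by
    intro q hq
    have h2 := contDiff_darbouxIter k hf
    rw [spaceLaplacian_velocityWave hf,
      ← darbouxIter_eulerPoissonDarboux (by convert hf using 2; ring) hq,
      timeDeriv_velocityWave (hf.of_le (by exact_mod_cast (by omega))),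
      timeDeriv_snd_mul_add ((contDiff_timeDeriv (j := 1) h2).differentiable (by norm_num))
        (h2.differentiable (by norm_num))]
    push_cast
    ring
  have c1 : Continuous (timeDeriv (timeDeriv (velocityWave f))) :=
    (contDiff_timeDeriv (j := 0)
      (contDiff_timeDeriv (j := 1) (contDiff_velocityWave hf))).continuous
  have c2 : Continuous (spaceLaplacian (velocityWave f)) :=
    (contDiff_spaceLaplacian (j := 0) (contDiff_velocityWave hf)).continuous
  have hc : (fun s => timeDeriv (timeDeriv (velocityWave f)) (p.1, s)) =ᶠ[𝓝[>] p.2]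
      fun s => spaceLaplacian (velocityWave f) (p.1, s) := by
    filter_upwards [self_mem_nhdsWithin] with s hs
    exact hpos _ (lt_of_le_of_lt hp hs)
  have l1 : Continuous fun s => timeDeriv (timeDeriv (velocityWave f)) (p.1, s) := by fun_prop
  have l2 : Continuous fun s => spaceLaplacian (velocityWave f) (p.1, s) := by fun_prop
  exact tendsto_nhds_unique ((l1.tendsto p.2).mono_left nhdsWithin_le_nhds)
    (((l2.tendsto p.2).mono_left nhdsWithin_le_nhds).congr' hc.symm)

theorem unitBallVolume_pos (n : ℕ) : 0 < unitBallVolume n :=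
  ENNReal.toReal_pos (Metric.measure_ball_pos volume _ one_pos).ne' measure_ball_lt_top.ne

theorem ballMean_zero_time (x : EuclideanSpace ℝ (Fin (2 * k + 2))) :
    ballMean f (x, 0) = unitBallVolume (2 * k + 2) * (Nat.doubleFactorial (2 * k + 2) : ℝ) /
      Nat.doubleFactorial (2 * k + 1) * f x := by
  rw [← integral_ball_inv_sqrt k, ← integral_mul_const, ← integral_ballMeasure (fun _ => f x)]
  simp [ballMean]

/-- The constant `d_n / v_n` normalises the initial velocity of `velocityWave f` to `f`: at
`t = 0` the Darboux steps contribute the factor `(n - 1)!!`, and the mean is `v_n n!! / (n - 1)!!`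
times `f`. -/
theorem timeDeriv_velocityWave_zero_time (hf : ContDiff ℝ (1 + k : ℕ) f)
    (x : EuclideanSpace ℝ (Fin (2 * k + 2))) :
    evenWaveConst (2 * k + 2) * (unitBallVolume (2 * k + 2))⁻¹ *
      timeDeriv (velocityWave f) (x, 0) = f x := by
  have h1 := darbouxIter_zero_time (f := f) (add_zero k) x
  have h2 := (unitBallVolume_pos (2 * k + 2)).ne'
  have h3 : (Nat.doubleFactorial (2 * k + 1) : ℝ) ≠ 0 := by positivity
  have h4 : (Nat.doubleFactorial (2 * k + 2) : ℝ) ≠ 0 := by positivity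
  rw [mul_zero, zero_add, show Nat.doubleFactorial 1 = 1 from rfl, Nat.cast_one, mul_one,
    ballMean_zero_time] at h1
  rw [timeDeriv_velocityWave hf, evenWaveConst]
  simp only [zero_mul, zero_add, one_mul, h1]
  field_simp

/-- The solution of the Cauchy problem, as a function defined for all real times. It is `C²` across
`t = 0`, so that the initial conditions are statements about its values there. -/
noncomputable def waveExtension (φ ψ : EuclideanSpace ℝ (Fin (2 * k + 2)) → ℝ)
    (p : EuclideanSpace ℝ (Fin (2 * k + 2)) × ℝ) : ℝ :=
  evenWaveConst (2 * k + 2) * (unitBallVolume (2 * k + 2))⁻¹ * timeDeriv (velocityWave φ) p +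
    evenWaveConst (2 * k + 2) * (unitBallVolume (2 * k + 2))⁻¹ * velocityWave ψ p

variable {φ ψ : EuclideanSpace ℝ (Fin (2 * k + 2)) → ℝ}

theorem evenWaveSolution_eq (hφ : ContDiff ℝ (1 + k : ℕ) φ) (hψ : ContDiff ℝ (1 + k : ℕ) ψ)
    (x : EuclideanSpace ℝ (Fin (2 * k + 2))) {t : ℝ} (ht : 0 < t) :
    evenWaveSolution φ ψ x t = waveExtension φ ψ (x, t) := by
  have hk : (2 * k + 2 - 2) / 2 = k := by omega
  have it : ∀ {f : EuclideanSpace ℝ (Fin (2 * k + 2)) → ℝ}, ContDiff ℝ (1 + k : ℕ) f →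
      ∀ s : ℝ, 0 < s → invMulDeriv^[k] (fun s => s ^ (2 * k + 2) * weightedBallMean s f x) s =
        (unitBallVolume (2 * k + 2))⁻¹ * velocityWave f (x, s) := by
    intro f hf s hs
    rw [iterate_invMulDeriv_eq (add_zero k) (hf.of_le (by exact_mod_cast (by omega))) x hs,
      velocityWave, mul_zero, zero_add, pow_one]
  have hev : invMulDeriv^[k] (fun s => s ^ (2 * k + 2) * weightedBallMean s φ x) =ᶠ[𝓝 t]
      fun s => (unitBallVolume (2 * k + 2))⁻¹ * velocityWave φ (x, s) := by
    filter_upwards [Ioi_mem_nhds ht] with s hs using it hφ s hs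
  have hd := (hasDerivAt_timeDeriv ((contDiff_velocityWave hφ).differentiable (by norm_num)) x
    t).const_mul (unitBallVolume (2 * k + 2))⁻¹
  rw [evenWaveSolution, hk, it hψ t ht, hev.deriv_eq, hd.deriv, waveExtension]
  ring

theorem isWaveCauchySolution_evenWaveSolution (hφ : ContDiff ℝ (3 + k : ℕ) φ)
    (hψ : ContDiff ℝ (2 + k : ℕ) ψ) : IsWaveCauchySolution φ ψ (evenWaveSolution φ ψ) := by
  have hφ2 : ContDiff ℝ (2 + k : ℕ) φ := hφ.of_le (by exact_mod_cast (by omega))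
  have hφ1 : ContDiff ℝ (1 + k : ℕ) φ := hφ.of_le (by exact_mod_cast (by omega))
  have hψ1 : ContDiff ℝ (1 + k : ℕ) ψ := hψ.of_le (by exact_mod_cast (by omega))
  set C := evenWaveConst (2 * k + 2) * (unitBallVolume (2 * k + 2))⁻¹ with hC
  set U := waveExtension φ ψ with hU
  have jφ3 : ContDiff ℝ 3 (velocityWave φ) := contDiff_velocityWave hφ
  have jφ2 : ContDiff ℝ 2 (timeDeriv (velocityWave φ)) := contDiff_timeDeriv (j := 2) jφ3
  have jφ1 : ContDiff ℝ 1 (timeDeriv (timeDeriv (velocityWave φ))) :=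
    contDiff_timeDeriv (j := 1) jφ2
  have jψ2 : ContDiff ℝ 2 (velocityWave ψ) := contDiff_velocityWave hψ
  have jψ1 : ContDiff ℝ 1 (timeDeriv (velocityWave ψ)) := contDiff_timeDeriv (j := 1) jψ2
  have hU2 : ContDiff ℝ 2 U := (contDiff_const.mul jφ2).add (contDiff_const.mul jψ2)
  have dU : Differentiable ℝ U := hU2.differentiable two_ne_zero
  have hUt : timeDeriv U = fun p =>
      C * timeDeriv (timeDeriv (velocityWave φ)) p + C * timeDeriv (velocityWave ψ) p :=
    timeDeriv_const_mul_add (jφ2.differentiable two_ne_zero) (jψ2.differentiable two_ne_zero) C C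
  have hUt1 : ContDiff ℝ 1 (timeDeriv U) := contDiff_timeDeriv (j := 1) hU2
  have dUt : Differentiable ℝ (timeDeriv U) := hUt1.differentiable one_ne_zero
  have heq : ∀ x t, 0 < t → evenWaveSolution φ ψ x t = U (x, t) := fun x t ht =>
    evenWaveSolution_eq hφ1 hψ1 x ht
  have hderiv : ∀ x t, 0 < t → deriv (evenWaveSolution φ ψ x) t = timeDeriv U (x, t) := by
    intro x t ht
    have hev : evenWaveSolution φ ψ x =ᶠ[𝓝 t] fun s => U (x, s) := by
      filter_upwards [Ioi_mem_nhds ht] with s hs using heq x s hs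
    rw [hev.deriv_eq, (hasDerivAt_timeDeriv dU x t).deriv]
  have hU0 : ∀ x, U (x, 0) = φ x := by
    intro x
    have h1 := timeDeriv_velocityWave_zero_time hφ1 x
    have h2 : velocityWave ψ (x, 0) = 0 := by simp [velocityWave]
    rw [hU, waveExtension, h1, h2, mul_zero, add_zero]
  have hUt0 : ∀ x, timeDeriv U (x, 0) = ψ x := by
    intro x
    have h1 := timeDeriv_velocityWave_zero_time hψ1 x
    -- The wave equation at `t = 0`, where `velocityWave φ` vanishes identically in `x`.
    have h2 : timeDeriv (timeDeriv (velocityWave φ)) (x, 0) = 0 := by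
      rw [velocityWave_wave_eq hφ2 le_rfl, spaceLaplacian_velocityWave hφ2, zero_mul]
    rw [hUt]
    simp only [h2, mul_zero, zero_add]
    exact h1
  refine ⟨?_, ?_, ?_, ?_, ?_⟩
  · exact hU2.contDiffOn.congr fun p hp => heq p.1 p.2 hp
  · intro x t ht
    have hev : deriv (evenWaveSolution φ ψ x) =ᶠ[𝓝 t] fun s => timeDeriv U (x, s) := by
      filter_upwards [Ioi_mem_nhds ht] with s hs using hderiv x s hs
    have hslice : (fun y => evenWaveSolution φ ψ y t) = fun y => U (y, t) :=
      funext fun y => heq y t ht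
    -- The time derivative of a `C³` solution of the wave equation is again a solution.
    have hw : timeDeriv (timeDeriv (timeDeriv (velocityWave φ))) (x, t) =
        spaceLaplacian (timeDeriv (velocityWave φ)) (x, t) := by
      rw [← timeDeriv_spaceLaplacian jφ3]
      exact timeDeriv_congr ht fun q hq => velocityWave_wave_eq hφ2 hq.le
    rw [hev.deriv_eq, (hasDerivAt_timeDeriv dUt x t).deriv, hslice,
      laplacian_slice_eq_spaceLaplacian hU2, hUt,
      timeDeriv_const_mul_add (jφ1.differentiable one_ne_zero) (jψ1.differentiable one_ne_zero)]
    simp only [hw, velocityWave_wave_eq hψ (p := (x, t)) ht.le]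
    exact (spaceLaplacian_const_mul_add jφ2 jψ2 C C (x, t)).symm
  · intro x
    rw [← hU0 x]
    refine ((hU2.continuous.tendsto (x, 0)).mono_left nhdsWithin_le_nhds).congr' ?_
    filter_upwards [self_mem_nhdsWithin] with p hp using (heq p.1 p.2 hp).symm
  · intro x
    rw [← hUt0 x]
    refine ((hUt1.continuous.tendsto (x, 0)).mono_left nhdsWithin_le_nhds).congr' ?_
    filter_upwards [self_mem_nhdsWithin] with p hp using (hderiv p.1 p.2 hp).symm
  · intro x
    have h := (hasDerivAt_timeDeriv dU x 0).hasDerivWithinAt (s := Ici 0)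
    rw [hUt0] at h
    refine h.congr_of_mem (fun s hs => ?_) self_mem_Ici
    rcases eq_or_lt_of_le (mem_Ici.1 hs) with rfl | hs'
    · rw [Function.update_self, hU0]
    · rw [Function.update_of_ne hs'.ne', heq x s hs']

theorem contDiffOn_pow_mul_weightedBallMean {j : ℕ}
    {f : EuclideanSpace ℝ (Fin (2 * k + 2)) → ℝ} (hf : ContDiff ℝ j f)
    (x : EuclideanSpace ℝ (Fin (2 * k + 2))) :
    ContDiffOn ℝ j (fun t => t ^ (2 * k + 2) * weightedBallMean t f x) (Ioi 0) := by
  have h1 : ContDiff ℝ j fun t : ℝ =>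
      (unitBallVolume (2 * k + 2))⁻¹ * (t ^ (2 * k + 1) * ballMean f (x, t)) :=
    contDiff_const.mul ((contDiff_id.pow _).mul ((contDiff_ballMean hf).comp
      (contDiff_prodMk_right x)))
  exact h1.contDiffOn.congr fun t ht => pow_mul_weightedBallMean f x ht

end VelocityWave

theorem evenWaveSolution_two (φ ψ : EuclideanSpace ℝ (Fin 2) → ℝ) (x : EuclideanSpace ℝ (Fin 2))
    {t : ℝ} (ht : 0 < t) :
    evenWaveSolution φ ψ x t =
      deriv (fun s => 1 / (2 * Real.pi) * weightedBallIntegral s φ x) t +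
        1 / (2 * Real.pi) * weightedBallIntegral t ψ x := by
  have hv : unitBallVolume 2 = Real.pi := by
    rw [unitBallVolume, EuclideanSpace.volume_ball_fin_two]
    simp [Real.pi_pos.le]
  have hc : evenWaveConst 2 = 1 / 2 := by norm_num [evenWaveConst, Nat.doubleFactorial]
  have hm : ∀ (f : EuclideanSpace ℝ (Fin 2) → ℝ) (s : ℝ), 0 < s →
      s ^ 2 * weightedBallMean s f x = 1 / Real.pi * weightedBallIntegral s f x := by
    intro f s hs
    rw [weightedBallMean, hv]
    field_simp
  have hev : (fun s => s ^ 2 * weightedBallMean s φ x) =ᶠ[𝓝 t]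
      fun s => 2 * (1 / (2 * Real.pi) * weightedBallIntegral s φ x) := by
    filter_upwards [Ioi_mem_nhds ht] with s hs
    rw [hm φ s hs]
    field_simp
  rw [evenWaveSolution, hc]
  simp only [Nat.sub_self, Nat.zero_div, Function.iterate_zero, id_eq]
  rw [hev.deriv_eq, deriv_const_mul_field', hm ψ t ht]
  field_simp

theorem mainTheorem2 (n : ℕ) (hn : Even n) (hn2 : 2 ≤ n)
    (φ ψ : EuclideanSpace ℝ (Fin n) → ℝ)
    (hφ : ContDiff ℝ (((n + 4) / 2 : ℕ) : WithTop ℕ∞) φ)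
    (hψ : ContDiff ℝ (((n + 2) / 2 : ℕ) : WithTop ℕ∞) ψ) :
    -- the integrals and the time derivatives in the formula exist
    (∀ (x : EuclideanSpace ℝ (Fin n)) (t : ℝ), 0 < t →
      IntegrableOn (fun y => 1 / Real.sqrt (t ^ 2 - ‖x - y‖ ^ 2) * φ y) (Metric.ball x t) ∧
      IntegrableOn (fun y => 1 / Real.sqrt (t ^ 2 - ‖x - y‖ ^ 2) * ψ y) (Metric.ball x t)) ∧
    (∀ x : EuclideanSpace ℝ (Fin n),
      ContDiffOn ℝ ((n / 2 : ℕ) : WithTop ℕ∞)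
        (fun t => t ^ n * weightedBallMean t φ x) (Ioi 0) ∧
      ContDiffOn ℝ (((n - 2) / 2 : ℕ) : WithTop ℕ∞)
        (fun t => t ^ n * weightedBallMean t ψ x) (Ioi 0)) ∧
    -- the formula solves the Cauchy problem
    IsWaveCauchySolution φ ψ (evenWaveSolution φ ψ) ∧
    -- for `n = 2` it is Poisson's formula
    (n = 2 → ∀ (x : EuclideanSpace ℝ (Fin n)) (t : ℝ), 0 < t →
      evenWaveSolution φ ψ x t =
        deriv (fun s => 1 / (2 * Real.pi) *
          ∫ y in Metric.ball x s, 1 / Real.sqrt (s ^ 2 - ‖x - y‖ ^ 2) * φ y) t +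
        1 / (2 * Real.pi) *
          ∫ y in Metric.ball x t, 1 / Real.sqrt (t ^ 2 - ‖x - y‖ ^ 2) * ψ y) := by

  obtain ⟨k, rfl⟩ : ∃ k, n = 2 * k + 2 := by
    obtain ⟨m, rfl⟩ := hn
    exact ⟨m - 1, by omega⟩
  rw [show (2 * k + 2 + 4) / 2 = 3 + k by omega] at hφ
  rw [show (2 * k + 2 + 2) / 2 = 2 + k by omega] at hψ
  refine ⟨fun x t ht => ⟨integrableOn_weight_mul hφ.continuous x ht,
    integrableOn_weight_mul hψ.continuous x ht⟩, fun x => ⟨?_, ?_⟩,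
    isWaveCauchySolution_evenWaveSolution hφ hψ, ?_⟩
  · exact contDiffOn_pow_mul_weightedBallMean (hφ.of_le (by exact_mod_cast (by omega))) x
  · exact contDiffOn_pow_mul_weightedBallMean (hψ.of_le (by exact_mod_cast (by omega))) x
  · intro h2 x t ht
    obtain rfl : k = 0 := by omega
    exact evenWaveSolution_two φ ψ x ht
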